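/- **Setting.** A free algebra $\mathbb{A}$ is a finite set $\mathcal{C}_{\mathbb{A}}=\{c_1^{\mathbb A},\dots,c_{k(\mathbb A)}^{\mathbb A}\}$ of constructors with an arity $\mathcal{R}(c)\in\mathbb{N}$ for each constructor $c$. Fix a finite family $\mathscr{A}$ of free algebras with pairwise disjoint constructor sets that contains the algebras $\mathbb{U}$ (arities $1,0$), $\mathbb{B}$ (arities $1,1,0$), $\mathbb{C}$ (arities $2,0$) and $\mathbb{D}$ (arities $2,2,0$). A binary string $s$ is encoded by a term $\ulcorner s\urcorner$ of $\mathbb{B}$: $\ulcorner\varepsilon\urcorner=c_3^{\mathbb B}$, $\ulcorner 0s\urcorner=c_1^{\mathbb B}\ulcorner s\urcorner$, $\ulcorner 1s\urcorner=c_2^{\mathbb B}\ulcorner s\urcorner$. *Terms* (up to renaming of bound variables) are $M::=x\mid c\mid MM\mid\lambda x.M\mid M\{\!\{M,\dots,M\}\!\}\mid M\langle\!\langle M,\dots,M\rangle\!\rangle$ with $c$ a constructor (the last two are conditional and recursion). *Values* are variables, abstractions, and terms built from constructors by application. Reduction $\leadsto$ is the closure of the following rules under $ML\leadsto NL$, $LM\leadsto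 LN$, $M\{\!\{\vec L\}\!\}\leadsto N\{\!\{\vec L\}\!\}$ and $M\langle\!\langle\vec L\rangle\!\rangle\leadsto N\langle\!\langle\vec L\rangle\!\rangle$ whenever $M\leadsto N$ (so not under abstractions or inside branches): $(\lambda x.M)V\leadsto M\{V/x\}$ for a value $V$, and, for $c_i\in\mathcal{C}_{\mathbb A}$ of arity $r$, for terms $t_1,\dots,t_r$ of the free algebra $\mathbb{A}$, and for $\vec M=M_1,\dots,M_{k(\mathbb A)}$, $$(c_i t_1\cdots t_r)\{\!\{\vec M\}\!\}\leadsto M_i t_1\cdots t_r,\qquad (c_i t_1\cdots t_r)\langle\!\langle\vec M\rangle\!\rangle\leadsto M_i t_1\cdots t_r\,(t_1\langle\!\langle\vec M\rangle\!\rangle)\cdots(t_r\langle\!\langle\vec M\rangle\!\rangle).$$ *Types* are $A::=\mathbb{A}^n\mid A\multimap A$ ($\mathbb{A}\in\mathscr{A}$, $n\in\mathbb{N}$), with level $V(\mathbb{A}^n)=n$, $V(A\multimap B)=\max\{V(A),V(B)\}$; $A\multimap^{k}B$ is $A\multimap\cdots\multimap A\multimap B$ with $k$ copies of $A$. For a class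 $\mathsf{D}$ of types, $\Gamma\vdash_{\mathsf{RH}(\mathsf{D})}M:A$ is generated by the following rules, where contexts separated by a comma have disjoint domains: - $x:A\vdash x:A$; - weakening: from $\Gamma\vdash M:B$ infer $\Gamma,x:A\vdash M:B$; - contraction, only if $A\in\mathsf{D}$: from $\Gamma,x:A,y:A\vdash M:B$ infer $\Gamma,z:A\vdash M\{z/x,z/y\}:B$; - from $\Gamma,x:A\vdash M:B$ infer $\Gamma\vdash\lambda x.M:A\multimap B$; - from $\Gamma\vdash M:A\multimap B$ and $\Delta\vdash N:A$ infer $\Gamma,\Delta\vdash MN:B$; - $\vdash c:\mathbb{A}^n\multimap^{\mathcal{R}(c)}\mathbb{A}^n$ for $c\in\mathcal{C}_{\mathbb A}$ and $n\in\mathbb{N}$; - conditional: from $\Gamma_i\vdash M_i:\mathbb{A}^m\multimap^{\mathcal{R}(c_i^{\mathbb A})}C$ for $i=1,\dots,k(\mathbb{A})$ and $\Delta\vdash L:\mathbb{A}^m$ infer $\Gamma_1,\dots,\Gamma_{k(\mathbb A)},\Delta\vdash L\{\!\{M_1,\dots,M_{k(\mathbb A)}\}\!\}:C$; - recursion, only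 if $m>V(C)$ and all types in $\Gamma_1,\dots,\Gamma_{k(\mathbb A)}$ are in $\mathsf{D}$: from $\Gamma_i\vdash M_i:\mathbb{A}^m\multimap^{\mathcal{R}(c_i^{\mathbb A})}C\multimap^{\mathcal{R}(c_i^{\mathbb A})}C$ for $i=1,\dots,k(\mathbb{A})$ and $\Delta\vdash L:\mathbb{A}^m$ infer $\Gamma_1,\dots,\Gamma_{k(\mathbb A)},\Delta\vdash L\langle\!\langle M_1,\dots,M_{k(\mathbb A)}\rangle\!\rangle:C$. Let $\mathsf{A}=\{\mathbb{A}^n\mid\mathbb{A}\in\mathscr{A},\,n\in\mathbb{N}\}$ be the class of all base types. A term $M$ *represents* $f:\{0,1\}^*\to\{0,1\}^*$ if $M\ulcorner s\urcorner\leadsto^*\ulcorner f(s)\urcorner$ for every $s\in\{0,1\}^*$. A function is computable in polynomial (elementary) time if some Turing machine computes it in a number of steps bounded by a polynomial (by a Kalmár elementary function) of the length of the input. **Theorem.** (1) For every polynomial time computable function $f:\{0,1\}^*\to\{0,1\}^*$ there are a term $M_f$ and an integer $n_f\ge 0$ such that $\vdash_{\mathsf{RH}(\emptyset)}M_f:\mathbb{B}^{n_f}\multimap\mathbb{B}^0$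 and $M_f$ represents $f$. (2) For every elementary time computable function $f:\{0,1\}^*\to\{0,1\}^*$ there are a term $M_f$ and an integer $n_f\ge 0$ such that $\vdash_{\mathsf{RH}(\mathsf{A})}M_f:\mathbb{B}^{n_f}\multimap\mathbb{B}^0$ and $M_f$ represents $f$. -/

import Mathlib

namespace LinRec

/-! ### Free algebras and the fixed family of free algebras -/

/-- A free algebra: finitely many constructors `0, …, numCon - 1`, each with an arity. -/
structure FreeAlgebra where
  numCon : ℕ
  arity : Fin numCon → ℕ

/-- A finite family of free algebras that contains the algebras `U` (unary strings), `B` (binary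
strings), `C` (binary trees) and `D` (binary trees with binary labels); the other members are
given by `extra`. -/
structure Family where
  numExtra : ℕ
  extra : Fin numExtra → FreeAlgebra

/-- Names for the members of a family. -/
inductive Idx (𝒜 : Family) : Type
  | U
  | B
  | C
  | D
  | other (j : Fin 𝒜.numExtra)

/-- The free algebra with a given name. -/
def Idx.alg {𝒜 : Family} : Idx 𝒜 → FreeAlgebra
  | .U => ⟨2, ![1, 0]⟩
  | .B => ⟨3, ![1, 1, 0]⟩
  | .C => ⟨2, ![2, 0]⟩
  | .D => ⟨3, ![2, 2, 0]⟩
  | .other j => 𝒜.extra j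

/-! ### Terms -/

/-- Terms, in de Bruijn notation, so that they are identified up to renaming of bound variables.
A constructor is a pair of (the name of) an algebra and a constructor of that algebra, so that
constructor sets of different algebras are disjoint.
`cond L k M` is the conditional `L {{M 0, …, M (k-1)}}` and `recur L k M` is the
recursion `L ⟨⟨M 0, …, M (k-1)⟩⟩`. -/
inductive Tm (𝒜 : Family) : Type
  | var (x : ℕ)
  | con (a : Idx 𝒜) (c : Fin a.alg.numCon)
  | app (M N : Tm 𝒜)
  | lam (M : Tm 𝒜)
  | cond (L : Tm 𝒜) (k : ℕ) (M : Fin k → Tm 𝒜)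
  | recur (L : Tm 𝒜) (k : ℕ) (M : Fin k → Tm 𝒜)

namespace Tm

variable {𝒜 : Family}

/-- Renaming of free variables. -/
def rename (ρ : ℕ → ℕ) : Tm 𝒜 → Tm 𝒜
  | var x => var (ρ x)
  | con a c => con a c
  | app M N => app (M.rename ρ) (N.rename ρ)
  | lam M => lam (M.rename (fun x => Nat.casesOn x 0 (fun y => ρ y + 1)))
  | cond L k M => cond (L.rename ρ) k (fun i => (M i).rename ρ)
  | recur L k M => recur (L.rename ρ) k (fun i => (M i).rename ρ)

/-- Simultaneous capture-avoiding substitution. -/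
def subst (σ : ℕ → Tm 𝒜) : Tm 𝒜 → Tm 𝒜
  | var x => σ x
  | con a c => con a c
  | app M N => app (M.subst σ) (N.subst σ)
  | lam M => lam (M.subst (fun x => Nat.casesOn x (var 0) (fun y => (σ y).rename Nat.succ)))
  | cond L k M => cond (L.subst σ) k (fun i => (M i).subst σ)
  | recur L k M => recur (L.subst σ) k (fun i => (M i).subst σ)

/-- `M{V/x}`, where `x` is the outermost free variable `0` of `M`. -/
def inst (M V : Tm 𝒜) : Tm 𝒜 :=
  M.subst (fun x => Nat.casesOn x V var)

/-- `M N₁ ⋯ Nₖ`. -/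
def apps (M : Tm 𝒜) (Ns : List (Tm 𝒜)) : Tm 𝒜 := Ns.foldl app M

/-- The terms built from constructors by application only. -/
inductive IsAlgebraic : Tm 𝒜 → Prop
  | con (a : Idx 𝒜) (c : Fin a.alg.numCon) : IsAlgebraic (con a c)
  | app {M N : Tm 𝒜} : IsAlgebraic M → IsAlgebraic N → IsAlgebraic (app M N)

/-- Values. -/
inductive IsValue : Tm 𝒜 → Prop
  | var (x : ℕ) : IsValue (var x)
  | lam (M : Tm 𝒜) : IsValue (lam M)
  | alg {M : Tm 𝒜} : IsAlgebraic M → IsValue M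

/-- `t` is a term of the free algebra `a`, i.e. `c t₁ ⋯ tₖ` with `c` a constructor of `a` of
arity `k` and `t₁, …, tₖ` terms of the free algebra `a`. -/
inductive IsFree (a : Idx 𝒜) : Tm 𝒜 → Prop
  | mk (c : Fin a.alg.numCon) (t : Fin (a.alg.arity c) → Tm 𝒜) (ht : ∀ j, IsFree a (t j)) :
      IsFree a ((con a c).apps (List.ofFn t))

/-! ### Weak call-by-value reduction -/

/-- The redexes and their contracta. -/
inductive Contract : Tm 𝒜 → Tm 𝒜 → Prop
  | beta (M V : Tm 𝒜) (hV : IsValue V) : Contract (app (lam M) V) (M.inst V)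
  | cond (a : Idx 𝒜) (c : Fin a.alg.numCon) (t : Fin (a.alg.arity c) → Tm 𝒜)
      (ht : ∀ j, IsFree a (t j)) (M : Fin a.alg.numCon → Tm 𝒜) :
      Contract (cond ((con a c).apps (List.ofFn t)) a.alg.numCon M)
        ((M c).apps (List.ofFn t))
  | recur (a : Idx 𝒜) (c : Fin a.alg.numCon) (t : Fin (a.alg.arity c) → Tm 𝒜)
      (ht : ∀ j, IsFree a (t j)) (M : Fin a.alg.numCon → Tm 𝒜) :
      Contract (recur ((con a c).apps (List.ofFn t)) a.alg.numCon M)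
        (((M c).apps (List.ofFn t)).apps
          (List.ofFn (fun j => recur (t j) a.alg.numCon M)))

/-- One-step reduction: no redex is fired under an abstraction or inside the branches of a
conditional or of a recursion. -/
inductive Step : Tm 𝒜 → Tm 𝒜 → Prop
  | contract {M N : Tm 𝒜} : Contract M N → Step M N
  | appL {M N : Tm 𝒜} (L : Tm 𝒜) : Step M N → Step (app M L) (app N L)
  | appR (L : Tm 𝒜) {M N : Tm 𝒜} : Step M N → Step (app L M) (app L N)
  | cond {M N : Tm 𝒜} (k : ℕ) (L : Fin k → Tm 𝒜) : Step M N → Step (cond M k L) (cond N k L)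
  | recur {M N : Tm 𝒜} (k : ℕ) (L : Fin k → Tm 𝒜) : Step M N → Step (recur M k L) (recur N k L)

/-- Many-step reduction. -/
def Steps : Tm 𝒜 → Tm 𝒜 → Prop := Relation.ReflTransGen Step

/-- The term of the algebra `B` that encodes a binary string. -/
def ofString : List Bool → Tm 𝒜
  | [] => con .B (2 : Fin 3)
  | false :: s => app (con .B (0 : Fin 3)) (ofString s)
  | true :: s => app (con .B (1 : Fin 3)) (ofString s)

/-- `M` represents the function `f` on binary strings. -/
def Represents (M : Tm 𝒜) (f : List Bool → List Bool) : Prop :=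
  ∀ s : List Bool, Steps (app M (ofString s)) (ofString (f s))

end Tm

/-! ### Types and type assignment -/

/-- Types: `base a n` is the base type of the algebra `a` with index (tier) `n`,
and `arrow A B` is the linear arrow from `A` to `B`. -/
inductive Ty (𝒜 : Family) : Type
  | base (a : Idx 𝒜) (n : ℕ)
  | arrow (A B : Ty 𝒜)

namespace Ty

variable {𝒜 : Family}

/-- The level of a type. -/
def level : Ty 𝒜 → ℕ
  | base _ n => n
  | arrow A B => max A.level B.level

/-- `A ⊸ ⋯ ⊸ A ⊸ B`, with `n` copies of `A`. -/
def arrows (A : Ty 𝒜) : ℕ → Ty 𝒜 → Ty 𝒜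
  | 0, B => B
  | n + 1, B => arrow A (arrows A n B)

/-- The class of all base types. -/
def baseTypes (𝒜 : Family) : Set (Ty 𝒜) := {A | ∃ a n, A = base a n}

end Ty

/-- Typing contexts: partial maps from variables to types. -/
def Ctx (𝒜 : Family) : Type := ℕ → Option (Ty 𝒜)

namespace Ctx

variable {𝒜 : Family}

/-- The empty context. -/
def empty : Ctx 𝒜 := fun _ => none

/-- The context `Γ, x : A` (used only when `x` is not declared in `Γ`). -/
def extend (Γ : Ctx 𝒜) (x : ℕ) (A : Ty 𝒜) : Ctx 𝒜 := fun y => if y = x then some A else Γ y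

/-- The context `Γ, x : A` for the body of an abstraction, with the bound variable as variable `0`
and the variables of `Γ` shifted by one. -/
def bind (A : Ty 𝒜) (Γ : Ctx 𝒜) : Ctx 𝒜 := fun x => Nat.casesOn x (some A) Γ

/-- `Γ` is the union of the contexts `Δ k`, and these have pairwise disjoint domains. -/
def IsDisjointUnion {κ : Type} (Δ : κ → Ctx 𝒜) (Γ : Ctx 𝒜) : Prop :=
  (∀ x k l, Δ k x ≠ none → Δ l x ≠ none → k = l) ∧
    ∀ x A, Γ x = some A ↔ ∃ k, Δ k x = some A

end Ctx

/-- `RH 𝒟 Γ M A` is the judgement `Γ ⊢ M : A` of the ramified system in which contraction, and the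
contexts of the branches of a recursion, are limited to types in the class `𝒟`. In the rules for
conditional and recursion, `Γs i` is the context of the `i`-th branch and `Δ` the context of the
principal argument. -/
inductive RH {𝒜 : Family} (𝒟 : Set (Ty 𝒜)) : Ctx 𝒜 → Tm 𝒜 → Ty 𝒜 → Prop
  | ax (x : ℕ) (A : Ty 𝒜) : RH 𝒟 (Ctx.empty.extend x A) (.var x) A
  | weak {Γ : Ctx 𝒜} {M : Tm 𝒜} {B : Ty 𝒜} (x : ℕ) (A : Ty 𝒜) (hx : Γ x = none) :
      RH 𝒟 Γ M B → RH 𝒟 (Γ.extend x A) M B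
  | contr {Γ : Ctx 𝒜} {M : Tm 𝒜} {B : Ty 𝒜} (x y z : ℕ) (A : Ty 𝒜) (hA : A ∈ 𝒟)
      (hxy : x ≠ y) (hx : Γ x = none) (hy : Γ y = none) (hz : Γ z = none) :
      RH 𝒟 ((Γ.extend x A).extend y A) M B →
      RH 𝒟 (Γ.extend z A) (M.rename (fun v => if v = x ∨ v = y then z else v)) B
  | lam {Γ : Ctx 𝒜} {M : Tm 𝒜} {A B : Ty 𝒜} :
      RH 𝒟 (Ctx.bind A Γ) M B → RH 𝒟 Γ (.lam M) (.arrow A B)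
  | app {Γ Δ Θ : Ctx 𝒜} {M N : Tm 𝒜} {A B : Ty 𝒜} (hΘ : Ctx.IsDisjointUnion ![Γ, Δ] Θ) :
      RH 𝒟 Γ M (.arrow A B) → RH 𝒟 Δ N A → RH 𝒟 Θ (.app M N) B
  | con (a : Idx 𝒜) (c : Fin a.alg.numCon) (n : ℕ) :
      RH 𝒟 Ctx.empty (.con a c) (Ty.arrows (.base a n) (a.alg.arity c) (.base a n))
  | cond (a : Idx 𝒜) (m : ℕ) {C : Ty 𝒜} {Γs : Fin a.alg.numCon → Ctx 𝒜} {Δ Θ : Ctx 𝒜}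
      {L : Tm 𝒜} {M : Fin a.alg.numCon → Tm 𝒜}
      (hΘ : Ctx.IsDisjointUnion (fun o : Option (Fin a.alg.numCon) => o.elim Δ Γs) Θ) :
      (∀ i, RH 𝒟 (Γs i) (M i) (Ty.arrows (.base a m) (a.alg.arity i) C)) →
      RH 𝒟 Δ L (.base a m) →
      RH 𝒟 Θ (.cond L a.alg.numCon M) C
  | recur (a : Idx 𝒜) (m : ℕ) {C : Ty 𝒜} {Γs : Fin a.alg.numCon → Ctx 𝒜} {Δ Θ : Ctx 𝒜}
      {L : Tm 𝒜} {M : Fin a.alg.numCon → Tm 𝒜}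
      (hΘ : Ctx.IsDisjointUnion (fun o : Option (Fin a.alg.numCon) => o.elim Δ Γs) Θ)
      (hΓs : ∀ i x A, Γs i x = some A → A ∈ 𝒟)
      (hm : C.level < m) :
      (∀ i, RH 𝒟 (Γs i) (M i)
        (Ty.arrows (.base a m) (a.alg.arity i) (Ty.arrows C (a.alg.arity i) C))) →
      RH 𝒟 Δ L (.base a m) →
      RH 𝒟 Θ (.recur L a.alg.numCon M) C

/-! ### Complexity classes -/

/-- The (Kalmár) elementary functions `ℕⁿ → ℕ`. -/
inductive Elementary : {n : ℕ} → ((Fin n → ℕ) → ℕ) → Prop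
  | zero {n : ℕ} : Elementary (fun _ : Fin n → ℕ => 0)
  | succ : Elementary (fun v : Fin 1 → ℕ => v 0 + 1)
  | proj {n : ℕ} (i : Fin n) : Elementary (fun v : Fin n → ℕ => v i)
  | add : Elementary (fun v : Fin 2 → ℕ => v 0 + v 1)
  | tsub : Elementary (fun v : Fin 2 → ℕ => v 0 - v 1)
  | comp {m n : ℕ} {f : (Fin m → ℕ) → ℕ} {g : Fin m → (Fin n → ℕ) → ℕ} :
      Elementary f → (∀ i, Elementary (g i)) → Elementary (fun v => f (fun i => g i v))
  | bsum {n : ℕ} {f : (Fin (n + 1) → ℕ) → ℕ} : Elementary f →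
      Elementary (fun v : Fin (n + 1) → ℕ =>
        ∑ i ∈ Finset.range (v 0), f (Fin.cons i (Fin.tail v)))
  | bprod {n : ℕ} {f : (Fin (n + 1) → ℕ) → ℕ} : Elementary f →
      Elementary (fun v : Fin (n + 1) → ℕ =>
        ∏ i ∈ Finset.range (v 0), f (Fin.cons i (Fin.tail v)))

/-- `f` is computed by a Turing machine whose running time is bounded by a polynomial in the
length of the input. -/
def PolyTimeComputable (f : List Bool → List Bool) : Prop :=
  Nonempty (Turing.TM2ComputableInPolyTime (id : List Bool → List Bool) id f)

/-- `f` is computed by a Turing machine whose running time is bounded by an elementary function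
of the length of the input. -/
def ElementaryTimeComputable (f : List Bool → List Bool) : Prop :=
  ∃ h : Turing.TM2ComputableInTime (id : List Bool → List Bool) id f,
    Elementary (fun v : Fin 1 → ℕ => h.time (v 0))

end LinRec

/-! A machine is simulated in the standard way. A configuration is coded by a binary tree of type
`treeTy`, one machine step is a closed term `treeTy ⊸ treeTy`, and this term is iterated at least as
often as the running time demands. Halting configurations are fixed points, so only an upper bound
on the running time matters. All branches of conditionals and recursions are closed terms, so the
side condition on contexts of recursions is vacuous, and the two systems differ only in whether
contraction is available.

The step (`exists_step`) needs no recursion. It inspects finitely many coded symbols and states by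
conditionals and reassembles what it has consumed. What linearity forbids to share is passed as an
argument after the conditional.

For polynomial time, iteration counts come from `Iterator.sum`. A recursion over a string of tier `m
> 1`, with the functional result type `treeTy ⊸ treeTy` of level 1, hands its step term both the
tail of the string and the recursive value. A previously built iterator can therefore be run on
every tail, which replaces the count `N` by `1 + ∑ i < n, N i` at the same tier. Repeating this from
the constant 1 dominates every polynomial, without contraction.

For elementary time, contraction on `C` is used exactly once, in `doubleTm`. A recursion over a
string of length `n` then builds the complete tree of depth `n`, and a recursion over that tree
composes `2 ^ n` successor functions. The resulting exponential (`exists_exp`) lowers the tier by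
two, so any fixed tower of exponentials is reached from a tier that is high enough, and towers
dominate all elementary functions (`Elementary.le_tower`).

The input is needed twice, as a clock and as data. `exists_dup` copies it without contraction, by a
recursion in continuation-passing style that costs one tier. `exists_represents` assembles the
pieces. -/

namespace LinRec

variable {𝒜 : Family}

namespace Tm

/-! ### Many-step reduction -/

theorem Steps.refl (M : Tm 𝒜) : Steps M M := Relation.ReflTransGen.refl

theorem Steps.trans {M N L : Tm 𝒜} (h : Steps M N) (h' : Steps N L) : Steps M L :=
  Relation.ReflTransGen.trans h h'

theorem Step.steps {M N : Tm 𝒜} (h : Step M N) : Steps M N := Relation.ReflTransGen.single h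

theorem Steps.lift {f : Tm 𝒜 → Tm 𝒜} (hf : ∀ M N, Step M N → Step (f M) (f N)) {M N : Tm 𝒜}
    (h : Steps M N) : Steps (f M) (f N) := by
  induction h with
  | refl => exact Steps.refl _
  | tail _ h ih => exact ih.trans (hf _ _ h).steps

theorem Steps.app {M M' N N' : Tm 𝒜} (hM : Steps M M') (hN : Steps N N') :
    Steps (M.app N) (M'.app N') :=
  (hM.lift (f := fun M => M.app N) fun _ _ => Step.appL N).trans
    (hN.lift (f := fun N => M'.app N) fun _ _ => Step.appR M')

theorem Steps.appR (M : Tm 𝒜) {N N' : Tm 𝒜} (hN : Steps N N') : Steps (M.app N) (M.app N') :=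
  (Steps.refl M).app hN

theorem Steps.appL {M M' : Tm 𝒜} (hM : Steps M M') (N : Tm 𝒜) : Steps (M.app N) (M'.app N) :=
  hM.app (Steps.refl N)

theorem Steps.recur {M N : Tm 𝒜} (k : ℕ) (L : Fin k → Tm 𝒜) (h : Steps M N) :
    Steps (recur M k L) (recur N k L) :=
  h.lift (f := fun M => Tm.recur M k L) fun _ _ => Step.recur k L

theorem Steps.beta {M V N : Tm 𝒜} (hV : IsValue V) (h : Steps (M.inst V) N) :
    Steps ((lam M).app V) N :=
  (Step.contract (.beta M V hV)).steps.trans h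

/-! ### Computing substitutions -/

/-- The substitution that maps `0` to `V` and `x + 1` to `σ x`. -/
def scons (V : Tm 𝒜) (σ : ℕ → Tm 𝒜) : ℕ → Tm 𝒜 := fun x => Nat.casesOn x V σ

/-- The substitution `σ` under a binder. -/
def up (σ : ℕ → Tm 𝒜) : ℕ → Tm 𝒜 := scons (var 0) fun y => (σ y).rename Nat.succ

/-- The renaming `ρ` under a binder. -/
def upr (ρ : ℕ → ℕ) : ℕ → ℕ := fun x => Nat.casesOn x 0 fun y => ρ y + 1

section

variable (σ : ℕ → Tm 𝒜) (ρ : ℕ → ℕ) (V M N : Tm 𝒜)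

@[simp] theorem scons_zero : scons V σ 0 = V := rfl
@[simp] theorem up_zero : up σ 0 = var 0 := rfl
@[simp] theorem up_one : up σ 1 = (σ 0).rename Nat.succ := rfl
@[simp] theorem up_two : up σ 2 = (σ 1).rename Nat.succ := rfl
@[simp] theorem up_three : up σ 3 = (σ 2).rename Nat.succ := rfl
@[simp] theorem upr_zero : upr ρ 0 = 0 := rfl
@[simp] theorem upr_one : upr ρ 1 = ρ 0 + 1 := rfl
@[simp] theorem upr_two : upr ρ 2 = ρ 1 + 1 := rfl
@[simp] theorem upr_three : upr ρ 3 = ρ 2 + 1 := rfl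
@[simp] theorem inst_eq : M.inst V = M.subst (scons V var) := rfl
@[simp] theorem subst_var (x : ℕ) : (var x).subst σ = σ x := rfl
@[simp] theorem subst_app : (M.app N).subst σ = (M.subst σ).app (N.subst σ) := rfl
@[simp] theorem subst_lam : M.lam.subst σ = (M.subst (up σ)).lam := rfl
@[simp] theorem rename_var (x : ℕ) : (var x : Tm 𝒜).rename ρ = var (ρ x) := rfl
@[simp] theorem rename_app : (M.app N).rename ρ = (M.rename ρ).app (N.rename ρ) := rfl
@[simp] theorem rename_lam : M.lam.rename ρ = (M.rename (upr ρ)).lam := rfl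

end

theorem Steps.beta₂ {M U V N : Tm 𝒜} (hU : IsValue U) (hV : IsValue V)
    (h : Steps ((M.subst (up (scons U var))).subst (scons V var)) N) :
    Steps (((lam (lam M)).app U).app V) N :=
  (Steps.appL (.beta hU (Steps.refl _)) _).trans (.beta hV h)

theorem Steps.beta₃ {M T U V N : Tm 𝒜} (hT : IsValue T) (hU : IsValue U) (hV : IsValue V)
    (h : Steps (((M.subst (up (up (scons T var)))).subst (up (scons U var))).subst
      (scons V var)) N) :
    Steps ((((lam (lam (lam M))).app T).app U).app V) N :=
  (Steps.appL (Steps.appL (.beta hT (Steps.refl _)) _) _).trans (.beta₂ hU hV h)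

theorem Steps.beta₄ {M S T U V N : Tm 𝒜} (hS : IsValue S) (hT : IsValue T) (hU : IsValue U)
    (hV : IsValue V)
    (h : Steps ((((M.subst (up (up (up (scons S var))))).subst (up (up (scons T var)))).subst
      (up (scons U var))).subst (scons V var)) N) :
    Steps (((((lam (lam (lam (lam M)))).app S).app T).app U).app V) N :=
  (Steps.appL (Steps.appL (Steps.appL (.beta hS (Steps.refl _)) _) _) _).trans (.beta₃ hT hU hV h)

/-! ### Closed terms -/

/-- Terms that are stable under substitution and renaming. -/
structure Closed (M : Tm 𝒜) : Prop where
  subst : ∀ σ, M.subst σ = M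
  rename : ∀ ρ, M.rename ρ = M

theorem Closed.app {M N : Tm 𝒜} (hM : M.Closed) (hN : N.Closed) : (M.app N).Closed :=
  ⟨fun σ => by simp [hM.subst, hN.subst],
    fun ρ => by simp [hM.rename, hN.rename]⟩

theorem Closed.con (a : Idx 𝒜) (c : Fin a.alg.numCon) : (con a c).Closed :=
  ⟨fun _ => rfl, fun _ => rfl⟩

/-! ### Conditional and recursion for binary strings and binary trees -/

/-- Conditional on a binary tree. -/
def matchC (L M₀ M₁ : Tm 𝒜) : Tm 𝒜 := cond L 2 ![M₀, M₁]

/-- Recursion on a binary tree. -/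
def recC (L M₀ M₁ : Tm 𝒜) : Tm 𝒜 := recur L 2 ![M₀, M₁]

/-- Recursion on a binary string. -/
def recB (L M₀ M₁ M₂ : Tm 𝒜) : Tm 𝒜 := recur L 3 ![M₀, M₁, M₂]

@[simp] theorem matchC_subst (L M₀ M₁ : Tm 𝒜) (σ) :
    (matchC L M₀ M₁).subst σ = matchC (L.subst σ) (M₀.subst σ) (M₁.subst σ) := by
  simp only [matchC, subst]; congr 1; funext i; fin_cases i <;> rfl

@[simp] theorem matchC_rename (L M₀ M₁ : Tm 𝒜) (ρ) :
    (matchC L M₀ M₁).rename ρ = matchC (L.rename ρ) (M₀.rename ρ) (M₁.rename ρ) := by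
  simp only [matchC, rename]; congr 1; funext i; fin_cases i <;> rfl

@[simp] theorem recC_subst (L M₀ M₁ : Tm 𝒜) (σ) :
    (recC L M₀ M₁).subst σ = recC (L.subst σ) (M₀.subst σ) (M₁.subst σ) := by
  simp only [recC, subst]; congr 1; funext i; fin_cases i <;> rfl

@[simp] theorem recC_rename (L M₀ M₁ : Tm 𝒜) (ρ) :
    (recC L M₀ M₁).rename ρ = recC (L.rename ρ) (M₀.rename ρ) (M₁.rename ρ) := by
  simp only [recC, rename]; congr 1; funext i; fin_cases i <;> rfl

@[simp] theorem recB_subst (L M₀ M₁ M₂ : Tm 𝒜) (σ) :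
    (recB L M₀ M₁ M₂).subst σ =
      recB (L.subst σ) (M₀.subst σ) (M₁.subst σ) (M₂.subst σ) := by
  simp only [recB, subst]; congr 1; funext i; fin_cases i <;> rfl

@[simp] theorem recB_rename (L M₀ M₁ M₂ : Tm 𝒜) (ρ) :
    (recB L M₀ M₁ M₂).rename ρ =
      recB (L.rename ρ) (M₀.rename ρ) (M₁.rename ρ) (M₂.rename ρ) := by
  simp only [recB, rename]; congr 1; funext i; fin_cases i <;> rfl

/-- The inner node of a binary tree. -/
def nodeTm (M N : Tm 𝒜) : Tm 𝒜 := ((con .C (0 : Fin 2)).app M).app N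

/-- The leaf of a binary tree. -/
def leafTm : Tm 𝒜 := con .C (1 : Fin 2)

@[simp] theorem nodeTm_subst (M N : Tm 𝒜) (σ) :
    (nodeTm M N).subst σ = nodeTm (M.subst σ) (N.subst σ) := rfl

@[simp] theorem nodeTm_rename (M N : Tm 𝒜) (ρ) :
    (nodeTm M N).rename ρ = nodeTm (M.rename ρ) (N.rename ρ) := rfl

@[simp] theorem leafTm_subst (σ) : (leafTm : Tm 𝒜).subst σ = leafTm := rfl

@[simp] theorem leafTm_rename (ρ) : (leafTm : Tm 𝒜).rename ρ = leafTm := rfl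

theorem Steps.nodeTm {M M' N N' : Tm 𝒜} (hM : Steps M M') (hN : Steps N N') :
    Steps (nodeTm M N) (nodeTm M' N') :=
  (Steps.appR _ hM).app hN

theorem IsFree.node {M N : Tm 𝒜} (hM : IsFree .C M) (hN : IsFree .C N) :
    IsFree .C (nodeTm M N) :=
  IsFree.mk (a := .C) (0 : Fin 2) ![M, N] fun j => by
    change Fin 2 at j
    fin_cases j
    exacts [hM, hN]

theorem IsFree.leaf : IsFree .C (leafTm : Tm 𝒜) :=
  IsFree.mk (a := .C) (1 : Fin 2) ![] fun j => Fin.elim0 (show Fin 0 from j)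

theorem IsFree.ofString : ∀ s, IsFree .B (ofString s : Tm 𝒜)
  | [] => IsFree.mk (a := .B) (2 : Fin 3) ![] fun j => Fin.elim0 (show Fin 0 from j)
  | false :: s => IsFree.mk (a := .B) (0 : Fin 3) ![Tm.ofString s] fun j => by
      change Fin 1 at j
      fin_cases j
      exact IsFree.ofString s
  | true :: s => IsFree.mk (a := .B) (1 : Fin 3) ![Tm.ofString s] fun j => by
      change Fin 1 at j
      fin_cases j
      exact IsFree.ofString s

theorem matchC_node {M N : Tm 𝒜} (hM : IsFree .C M) (hN : IsFree .C N) (M₀ M₁ : Tm 𝒜) :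
    Steps (matchC (nodeTm M N) M₀ M₁) ((M₀.app M).app N) :=
  (Step.contract (.cond .C (0 : Fin 2) ![M, N] (fun j => by
    change Fin 2 at j
    fin_cases j
    exacts [hM, hN]) ![M₀, M₁])).steps

theorem matchC_leaf (M₀ M₁ : Tm 𝒜) : Steps (matchC leafTm M₀ M₁) M₁ :=
  (Step.contract (.cond .C (1 : Fin 2) ![] (fun j => Fin.elim0 (show Fin 0 from j))
    ![M₀, M₁])).steps

theorem recC_node {M N : Tm 𝒜} (hM : IsFree .C M) (hN : IsFree .C N) (M₀ M₁ : Tm 𝒜) :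
    Steps (recC (nodeTm M N) M₀ M₁)
      ((((M₀.app M).app N).app (recC M M₀ M₁)).app (recC N M₀ M₁)) :=
  (Step.contract (.recur .C (0 : Fin 2) ![M, N] (fun j => by
    change Fin 2 at j
    fin_cases j
    exacts [hM, hN]) ![M₀, M₁])).steps

theorem recC_leaf (M₀ M₁ : Tm 𝒜) : Steps (recC leafTm M₀ M₁) M₁ :=
  (Step.contract (.recur .C (1 : Fin 2) ![] (fun j => Fin.elim0 (show Fin 0 from j))
    ![M₀, M₁])).steps

theorem recB_nil (M₀ M₁ M₂ : Tm 𝒜) : Steps (recB (ofString []) M₀ M₁ M₂) M₂ :=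
  (Step.contract (.recur .B (2 : Fin 3) ![] (fun j => Fin.elim0 (show Fin 0 from j))
    ![M₀, M₁, M₂])).steps

theorem recB_cons (b : Bool) (s : List Bool) (M₀ M₁ M₂ : Tm 𝒜) :
    Steps (recB (ofString (b :: s)) M₀ M₁ M₂)
      (((bif b then M₁ else M₀).app (ofString s)).app (recB (ofString s) M₀ M₁ M₂)) := by
  cases b
  · exact (Step.contract (.recur .B (0 : Fin 3) ![ofString s] (fun j => by
      change Fin 1 at j
      fin_cases j
      exact IsFree.ofString s) ![M₀, M₁, M₂])).steps
  · exact (Step.contract (.recur .B (1 : Fin 3) ![ofString s] (fun j => by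
      change Fin 1 at j
      fin_cases j
      exact IsFree.ofString s) ![M₀, M₁, M₂])).steps

/-- The constructor of `B` for a bit. -/
def bitTm (b : Bool) : Tm 𝒜 := bif b then con .B (1 : Fin 3) else con .B (0 : Fin 3)

theorem bitTm_closed (b : Bool) : (bitTm b : Tm 𝒜).Closed := by
  cases b <;> exact Closed.con _ _

theorem ofString_cons (b : Bool) (s : List Bool) :
    (ofString (b :: s) : Tm 𝒜) = (bitTm b).app (ofString s) := by
  cases b <;> rfl

theorem ofString_closed : ∀ s, (ofString s : Tm 𝒜).Closed
  | [] => Closed.con _ _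
  | b :: s => by
      rw [ofString_cons]
      exact (bitTm_closed b).app (ofString_closed s)

theorem ofString_isAlgebraic : ∀ s, (ofString s : Tm 𝒜).IsAlgebraic
  | [] => .con _ _
  | false :: s => .app (.con _ _) (ofString_isAlgebraic s)
  | true :: s => .app (.con _ _) (ofString_isAlgebraic s)

theorem ofString_isValue (s : List Bool) : (ofString s : Tm 𝒜).IsValue :=
  .alg (ofString_isAlgebraic s)

end Tm

/-! ### Type assignment with input and output contexts -/

open Tm

variable {𝒟 : Set (Ty 𝒜)}

/-- The context `l` without the variables that are declared in `l'`. -/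
def Ctx.sdiff (l l' : List (Option (Ty 𝒜))) : Ctx 𝒜 :=
  fun x => if (l'.getD x none).isSome then none else l.getD x none

/-- `M` has type `A` in the part of the context `l` that is not in `l'`: the context `l'` is what
is left of `l` after the variables used by `M` have been removed. -/
structure Uses (𝒟 : Set (Ty 𝒜)) (l : List (Option (Ty 𝒜))) (M : Tm 𝒜) (A : Ty 𝒜)
    (l' : List (Option (Ty 𝒜))) : Prop where
  sub : ∀ x B, l'.getD x none = some B → l.getD x none = some B
  rh : RH 𝒟 (Ctx.sdiff l l') M A

theorem Ctx.sdiff_self (l : List (Option (Ty 𝒜))) : Ctx.sdiff l l = Ctx.empty := by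
  funext x
  unfold Ctx.sdiff Ctx.empty
  cases h : l.getD x none <;> simp

theorem Uses.closed {l : List (Option (Ty 𝒜))} {M : Tm 𝒜} {A : Ty 𝒜}
    (h : RH 𝒟 Ctx.empty M A) : Uses 𝒟 l M A l :=
  ⟨fun _ _ h => h, by rwa [Ctx.sdiff_self]⟩

theorem Uses.toRH {M : Tm 𝒜} {A : Ty 𝒜} (h : Uses 𝒟 [] M A []) : RH 𝒟 Ctx.empty M A := by
  simpa [Ctx.sdiff_self] using h.rh

theorem Uses.var {l : List (Option (Ty 𝒜))} (x : ℕ) {A : Ty 𝒜} (h : l[x]? = some (some A)) :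
    Uses 𝒟 l (.var x) A (l.set x none) := by
  have hx : l.getD x none = some A := by simp [List.getD, h]
  have hlt : x < l.length := by
    by_contra hc
    simp [List.getElem?_eq_none (not_lt.1 hc)] at h
  have key : ∀ y, (l.set x none).getD y none = if y = x then none else l.getD y none := by
    intro y
    by_cases hy : y = x
    · subst hy; simp [List.getD, hlt]
    · simp [List.getD, hy, Ne.symm hy]
  refine ⟨fun y B hy => ?_, ?_⟩
  · rw [key] at hy
    split_ifs at hy
    exact hy
  · have : Ctx.sdiff l (l.set x none) = Ctx.empty.extend x A := by
      funext y
      unfold Ctx.sdiff Ctx.extend Ctx.empty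
      rw [key]
      by_cases hy : y = x
      · subst hy; simp only [if_true]; simpa using hx
      · simp only [hy, if_false]
        cases l.getD y none <;> simp
    rw [this]
    exact .ax x A

/-- The entry `o` left for the bound variable tells whether the body has consumed it (`none`) or not
(`some`). In the second case weakening supplies it. -/
theorem Uses.lam {l l' : List (Option (Ty 𝒜))} {o : Option (Ty 𝒜)} {M : Tm 𝒜} {A B : Ty 𝒜}
    (h : Uses 𝒟 (some A :: l) M B (o :: l')) : Uses 𝒟 l (.lam M) (.arrow A B) l' := by
  refine ⟨fun x C hx => h.sub (x + 1) C (by simpa using hx), ?_⟩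
  refine .lam ?_
  have hb : Ctx.bind A (Ctx.sdiff l l') = Ctx.extend (Ctx.sdiff (some A :: l) (o :: l')) 0 A := by
    funext x
    cases x with
    | zero => simp [Ctx.bind, Ctx.extend]
    | succ x => simp [Ctx.bind, Ctx.extend, Ctx.sdiff]
  cases o with
  | none =>
    have : Ctx.bind A (Ctx.sdiff l l') = Ctx.sdiff (some A :: l) (none :: l') := by
      rw [hb]
      funext x
      cases x <;> simp [Ctx.extend, Ctx.sdiff]
    rw [this]
    exact h.rh
  | some C =>
    rw [hb]
    exact .weak 0 A (by simp [Ctx.sdiff]) h.rh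

/-- What is removed first and what is removed from the remainder cannot overlap. Threading the
remaining context through a term thus yields the disjoint splitting demanded by multiplicative
rules. -/
theorem Ctx.sdiff_union {l l₁ l₂ : List (Option (Ty 𝒜))}
    (h₁ : ∀ x B, l₁.getD x none = some B → l.getD x none = some B)
    (h₂ : ∀ x B, l₂.getD x none = some B → l₁.getD x none = some B) :
    Ctx.IsDisjointUnion ![Ctx.sdiff l l₁, Ctx.sdiff l₁ l₂] (Ctx.sdiff l l₂) := by
  constructor
  · intro x i j hi hj
    fin_cases i <;> fin_cases j <;> simp_all [Ctx.sdiff]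
  · intro x A
    have h₁ := h₁ x
    have h₂ := h₂ x
    simp only [Ctx.sdiff, Fin.exists_fin_two, Matrix.cons_val_zero, Matrix.cons_val_one]
    revert h₁ h₂
    generalize l.getD x none = a
    generalize l₁.getD x none = b
    generalize l₂.getD x none = c
    intro h₁ h₂
    cases a <;> cases b <;> cases c <;> simp_all

theorem Uses.app {l l₁ l₂ : List (Option (Ty 𝒜))} {M N : Tm 𝒜} {A B : Ty 𝒜}
    (hM : Uses 𝒟 l M (.arrow A B) l₁) (hN : Uses 𝒟 l₁ N A l₂) : Uses 𝒟 l (.app M N) B l₂ :=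
  ⟨fun x C h => hM.sub x C (hN.sub x C h), .app (Ctx.sdiff_union hM.sub hN.sub) hM.rh hN.rh⟩

theorem Ctx.isDisjointUnion_option (κ : Type) (Δ : Ctx 𝒜) :
    Ctx.IsDisjointUnion (fun o : Option κ => o.elim Δ fun _ => Ctx.empty) Δ := by
  constructor
  · intro x i j hi hj
    cases i <;> cases j <;> simp_all [Ctx.empty]
  · intro x A
    constructor
    · exact fun h => ⟨none, h⟩
    · rintro ⟨_ | i, h⟩
      · exact h
      · simp [Ctx.empty] at h

theorem Uses.matchC {l l' : List (Option (Ty 𝒜))} {L M₀ M₁ : Tm 𝒜} {m : ℕ} {R : Ty 𝒜}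
    (hL : Uses 𝒟 l L (.base .C m) l')
    (h₀ : RH 𝒟 Ctx.empty M₀ (.arrow (.base .C m) (.arrow (.base .C m) R)))
    (h₁ : RH 𝒟 Ctx.empty M₁ R) : Uses 𝒟 l (Tm.matchC L M₀ M₁) R l' :=
  ⟨hL.sub, RH.cond .C m (Γs := fun _ => Ctx.empty) (M := ![M₀, M₁])
    (Ctx.isDisjointUnion_option _ _) (fun i => by
      change Fin 2 at i
      fin_cases i
      exacts [h₀, h₁]) hL.rh⟩

/-- Since the branches are closed, the requirement that their contexts lie in `𝒟` is empty, even for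
`𝒟 = ∅`. -/
theorem Uses.recC {l l' : List (Option (Ty 𝒜))} {L M₀ M₁ : Tm 𝒜} {m : ℕ} {R : Ty 𝒜}
    (hm : R.level < m) (hL : Uses 𝒟 l L (.base .C m) l')
    (h₀ : RH 𝒟 Ctx.empty M₀ (.arrow (.base .C m) (.arrow (.base .C m) (.arrow R (.arrow R R)))))
    (h₁ : RH 𝒟 Ctx.empty M₁ R) : Uses 𝒟 l (Tm.recC L M₀ M₁) R l' :=
  ⟨hL.sub, RH.recur .C m (Γs := fun _ => Ctx.empty) (M := ![M₀, M₁])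
    (Ctx.isDisjointUnion_option _ _) (fun i x A h => by simp [Ctx.empty] at h) hm (fun i => by
      change Fin 2 at i
      fin_cases i
      exacts [h₀, h₁]) hL.rh⟩

theorem Uses.recB {l l' : List (Option (Ty 𝒜))} {L M₀ M₁ M₂ : Tm 𝒜} {m : ℕ} {R : Ty 𝒜}
    (hm : R.level < m) (hL : Uses 𝒟 l L (.base .B m) l')
    (h₀ : RH 𝒟 Ctx.empty M₀ (.arrow (.base .B m) (.arrow R R)))
    (h₁ : RH 𝒟 Ctx.empty M₁ (.arrow (.base .B m) (.arrow R R)))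
    (h₂ : RH 𝒟 Ctx.empty M₂ R) : Uses 𝒟 l (Tm.recB L M₀ M₁ M₂) R l' :=
  ⟨hL.sub, RH.recur .B m (Γs := fun _ => Ctx.empty) (M := ![M₀, M₁, M₂])
    (Ctx.isDisjointUnion_option _ _) (fun i x A h => by simp [Ctx.empty] at h) hm (fun i => by
      change Fin 3 at i
      fin_cases i
      exacts [h₀, h₁, h₂]) hL.rh⟩

theorem rh_leafTm (m : ℕ) : RH 𝒟 Ctx.empty leafTm (.base .C m) :=
  RH.con .C (1 : Fin 2) m

theorem rh_bitTm (b : Bool) (m : ℕ) :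
    RH 𝒟 Ctx.empty (bitTm b) (.arrow (.base .B m) (.base .B m)) := by
  cases b
  exacts [RH.con .B (0 : Fin 3) m, RH.con .B (1 : Fin 3) m]

theorem rh_nil (m : ℕ) : RH 𝒟 Ctx.empty (ofString []) (.base .B m) :=
  RH.con .B (2 : Fin 3) m

theorem Uses.nodeTm {l l₁ l₂ : List (Option (Ty 𝒜))} {M N : Tm 𝒜} {m : ℕ}
    (hM : Uses 𝒟 l M (.base .C m) l₁) (hN : Uses 𝒟 l₁ N (.base .C m) l₂) :
    Uses 𝒟 l (Tm.nodeTm M N) (.base .C m) l₂ :=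
  .app (.app (.closed (RH.con .C (0 : Fin 2) m)) hM) hN

/-! ### Binary trees and their terms. -/

/-- Binary trees. -/
inductive BinTree : Type
  | leaf
  | node (a b : BinTree)

namespace BinTree

/-- The term of the algebra `C` for a binary tree. -/
def toTm : BinTree → Tm 𝒜
  | leaf => leafTm
  | node a b => nodeTm a.toTm b.toTm

theorem toTm_closed : ∀ t : BinTree, (t.toTm : Tm 𝒜).Closed
  | leaf => Closed.con _ _
  | node a b => ((Closed.con _ _).app a.toTm_closed).app b.toTm_closed

@[simp] theorem toTm_subst (t : BinTree) (σ) : (t.toTm : Tm 𝒜).subst σ = t.toTm :=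
  t.toTm_closed.subst σ

@[simp] theorem toTm_rename (t : BinTree) (ρ) : (t.toTm : Tm 𝒜).rename ρ = t.toTm :=
  t.toTm_closed.rename ρ

theorem toTm_isFree : ∀ t : BinTree, IsFree .C (t.toTm : Tm 𝒜)
  | leaf => .leaf
  | node a b => .node a.toTm_isFree b.toTm_isFree

theorem toTm_isAlgebraic : ∀ t : BinTree, (t.toTm : Tm 𝒜).IsAlgebraic
  | leaf => .con _ _
  | node a b => .app (.app (.con _ _) a.toTm_isAlgebraic) b.toTm_isAlgebraic

theorem toTm_isValue (t : BinTree) : (t.toTm : Tm 𝒜).IsValue := .alg t.toTm_isAlgebraic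

theorem toTm_rh (m : ℕ) : ∀ t : BinTree, RH 𝒟 Ctx.empty (t.toTm : Tm 𝒜) (.base .C m)
  | leaf => rh_leafTm m
  | node a b => (Uses.nodeTm (.closed (a.toTm_rh m)) (.closed (b.toTm_rh m))).toRH

/-- Unary numerals as binary trees. -/
def num : ℕ → BinTree
  | 0 => leaf
  | n + 1 => node leaf (num n)

end BinTree

open BinTree

/-! ### Linear combinators for functions on binary trees. -/

/-- A closed term with a type. -/
structure Comb (𝒟 : Set (Ty 𝒜)) (M : Tm 𝒜) (A : Ty 𝒜) : Prop where
  closed : M.Closed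
  rh : RH 𝒟 Ctx.empty M A

/-- The type of the binary trees that represent the configurations of a machine. -/
abbrev treeTy : Ty 𝒜 := .base .C 1

/-- `A ⊸ treeTy`. -/
abbrev toTree (A : Ty 𝒜) : Ty 𝒜 := .arrow A treeTy

/-- Functions on binary trees that are computed by a closed term. -/
def Real₁ (𝒟 : Set (Ty 𝒜)) (f : BinTree → BinTree) : Prop :=
  ∃ M, Comb 𝒟 M (toTree treeTy) ∧ ∀ a, Steps (M.app a.toTm) (f a).toTm

/-- Binary functions on binary trees that are computed by a closed term. -/
def Real₂ (𝒟 : Set (Ty 𝒜)) (f : BinTree → BinTree → BinTree) : Prop :=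
  ∃ M, Comb 𝒟 M (.arrow treeTy (toTree treeTy)) ∧
    ∀ a b, Steps ((M.app a.toTm).app b.toTm) (f a b).toTm

/-- Ternary functions on binary trees that are computed by a closed term. -/
def Real₃ (𝒟 : Set (Ty 𝒜)) (f : BinTree → BinTree → BinTree → BinTree) : Prop :=
  ∃ M, Comb 𝒟 M (.arrow treeTy (.arrow treeTy (toTree treeTy))) ∧
    ∀ a b c, Steps (((M.app a.toTm).app b.toTm).app c.toTm) (f a b c).toTm

theorem Real₁.comp {f g : BinTree → BinTree} (hf : Real₁ 𝒟 f) (hg : Real₁ 𝒟 g) :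
    Real₁ 𝒟 (fun a => f (g a)) := by
  obtain ⟨F, hF, hf⟩ := hf
  obtain ⟨G, hG, hg⟩ := hg
  refine ⟨lam (F.app (G.app (.var 0))), ⟨⟨?_, ?_⟩, ?_⟩, fun a => ?_⟩
  · intro σ
    simp [hF.closed.subst, hG.closed.subst]
  · intro σ
    simp [hF.closed.rename, hG.closed.rename]
  · exact (Uses.lam (.app (.closed hF.rh) (.app (.closed hG.rh) (.var 0 rfl)))).toRH
  · refine .beta a.toTm_isValue ?_
    simp [hF.closed.subst, hG.closed.subst]
    exact (Steps.appR _ (hg a)).trans (hf _)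

theorem Real₂.elim {f : BinTree → BinTree → BinTree} (hf : Real₂ 𝒟 f) (g : BinTree) :
    Real₁ 𝒟 (fun t => BinTree.casesOn t g f) := by
  obtain ⟨F, hF, hf⟩ := hf
  refine ⟨lam (matchC (.var 0) F g.toTm), ⟨⟨?_, ?_⟩, ?_⟩, fun a => ?_⟩
  · intro σ
    simp [hF.closed.subst]
  · intro σ
    simp [hF.closed.rename]
  · exact (Uses.lam (.matchC (.var 0 rfl) hF.rh (g.toTm_rh _))).toRH
  · refine .beta a.toTm_isValue ?_
    simp [hF.closed.subst]
    cases a with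
    | leaf => exact matchC_leaf _ _
    | node a b => exact (matchC_node a.toTm_isFree b.toTm_isFree _ _).trans (hf a b)

theorem Real₁.id : Real₁ 𝒟 (fun a => a) :=
  ⟨lam (.var 0), ⟨⟨fun _ => rfl, fun _ => rfl⟩, (Uses.lam (.var 0 rfl)).toRH⟩,
    fun a => .beta a.toTm_isValue (Steps.refl _)⟩

theorem Real₁.pair (c : BinTree) : Real₁ 𝒟 (fun a => node c a) :=
  ⟨lam (nodeTm c.toTm (.var 0)), ⟨⟨fun σ => by simp, fun σ => by simp⟩,
    (Uses.lam (.nodeTm (.closed (c.toTm_rh _)) (.var 0 rfl))).toRH⟩,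
    fun a => .beta a.toTm_isValue (by simpa [toTm] using Steps.refl _)⟩

theorem Real₂.fst : Real₂ 𝒟 (fun a _ => a) :=
  ⟨lam (lam (.var 1)), ⟨⟨fun _ => rfl, fun _ => rfl⟩, (Uses.lam (.lam (.var 1 rfl))).toRH⟩,
    fun a b => .beta₂ a.toTm_isValue b.toTm_isValue (by simpa using Steps.refl _)⟩

theorem Real₂.snd : Real₂ 𝒟 (fun _ b => b) :=
  ⟨lam (lam (.var 0)), ⟨⟨fun _ => rfl, fun _ => rfl⟩, (Uses.lam (.lam (.var 0 rfl))).toRH⟩,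
    fun a b => .beta₂ a.toTm_isValue b.toTm_isValue (by simpa using Steps.refl _)⟩

/-- Together with `Real₂.elim` this applies a function to the second component of a pair. -/
theorem Real₁.right {f : BinTree → BinTree} (hf : Real₁ 𝒟 f) :
    Real₂ 𝒟 (fun a b => node a (f b)) := by
  obtain ⟨F, hF, hf⟩ := hf
  refine ⟨lam (lam (nodeTm (.var 1) (F.app (.var 0)))), ⟨⟨?_, ?_⟩, ?_⟩, fun a b => ?_⟩
  · intro σ
    simp [hF.closed.subst]
  · intro σ
    simp [hF.closed.rename]
  · exact (Uses.lam (.lam (.nodeTm (.var 1 rfl) (.app (.closed hF.rh) (.var 0 rfl))))).toRH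
  · refine .beta₂ a.toTm_isValue b.toTm_isValue ?_
    simp [hF.closed.subst]
    exact (Steps.refl _).nodeTm (hf b)

theorem Real₂.drop {f : BinTree → BinTree → BinTree} (hf : Real₂ 𝒟 f) :
    Real₃ 𝒟 (fun _ b c => f b c) := by
  obtain ⟨F, hF, hf⟩ := hf
  refine ⟨lam F, ⟨⟨?_, ?_⟩, (Uses.lam (.closed hF.rh)).toRH⟩, fun a b c => ?_⟩
  · intro σ
    simp [hF.closed.subst]
  · intro σ
    simp [hF.closed.rename]
  · refine ((Steps.appL (Steps.appL (.beta a.toTm_isValue ?_) _) _)).trans (hf b c)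
    simp [hF.closed.subst]
    exact Steps.refl _

/-- The branches of a conditional have disjoint contexts and cannot share the variable for `b`. So
the conditional returns a function, and `b` is applied to it from outside. -/
theorem Real₃.elim_left {f : BinTree → BinTree → BinTree → BinTree} {g : BinTree → BinTree}
    (hf : Real₃ 𝒟 f) (hg : Real₁ 𝒟 g) :
    Real₂ 𝒟 (fun a b => BinTree.casesOn a (g b) (fun c d => f c d b)) := by
  obtain ⟨F, hF, hf⟩ := hf
  obtain ⟨G, hG, hg⟩ := hg
  refine ⟨lam (lam ((matchC (.var 1) F G).app (.var 0))), ⟨⟨?_, ?_⟩, ?_⟩, fun a b => ?_⟩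
  · intro σ
    simp [hF.closed.subst, hG.closed.subst]
  · intro σ
    simp [hF.closed.rename, hG.closed.rename]
  · exact (Uses.lam (.lam (.app (.matchC (.var 1 rfl) hF.rh hG.rh) (.var 0 rfl)))).toRH
  · refine .beta₂ a.toTm_isValue b.toTm_isValue ?_
    simp [hF.closed.subst, hG.closed.subst]
    cases a with
    | leaf => exact (Steps.appL (matchC_leaf _ _) _).trans (hg b)
    | node c d =>
      exact (Steps.appL (matchC_node c.toTm_isFree d.toTm_isFree _ _) _).trans (hf c d b)

theorem Real₃.elim_right {f : BinTree → BinTree → BinTree → BinTree} {g : BinTree → BinTree}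
    (hf : Real₃ 𝒟 f) (hg : Real₁ 𝒟 g) :
    Real₂ 𝒟 (fun a b => BinTree.casesOn b (g a) (fun c d => f c d a)) := by
  obtain ⟨F, hF, hf⟩ := hf
  obtain ⟨G, hG, hg⟩ := hg
  refine ⟨lam (lam ((matchC (.var 0) F G).app (.var 1))), ⟨⟨?_, ?_⟩, ?_⟩, fun a b => ?_⟩
  · intro σ
    simp [hF.closed.subst, hG.closed.subst]
  · intro σ
    simp [hF.closed.rename, hG.closed.rename]
  · exact (Uses.lam (.lam (.app (.matchC (.var 0 rfl) hF.rh hG.rh) (.var 1 rfl)))).toRH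
  · refine .beta₂ a.toTm_isValue b.toTm_isValue ?_
    simp [hF.closed.subst, hG.closed.subst]
    cases b with
    | leaf => exact (Steps.appL (matchC_leaf _ _) _).trans (hg a)
    | node c d =>
      exact (Steps.appL (matchC_node c.toTm_isFree d.toTm_isFree _ _) _).trans (hf c d a)

/-- `(c, d, a) ↦ (c, (a, d))`. -/
theorem Real₃.exchange : Real₃ 𝒟 (fun c d a => node c (node a d)) := by
  refine ⟨lam (lam (lam (nodeTm (.var 2) (nodeTm (.var 0) (.var 1))))),
    ⟨⟨fun _ => rfl, fun _ => rfl⟩, ?_⟩,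
    fun a b c => .beta₃ a.toTm_isValue b.toTm_isValue c.toTm_isValue ?_⟩
  · exact (Uses.lam (.lam (.lam (.nodeTm (.var 2 rfl) (.nodeTm (.var 0 rfl) (.var 1 rfl)))))).toRH
  · simpa [toTm] using Steps.refl _

/-- `(c, d, a) ↦ ((a, c), d)`. -/
theorem Real₃.assoc : Real₃ 𝒟 (fun c d a => node (node a c) d) := by
  refine ⟨lam (lam (lam (nodeTm (nodeTm (.var 0) (.var 2)) (.var 1)))),
    ⟨⟨fun _ => rfl, fun _ => rfl⟩, ?_⟩,
    fun a b c => .beta₃ a.toTm_isValue b.toTm_isValue c.toTm_isValue ?_⟩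
  · exact (Uses.lam (.lam (.lam (.nodeTm (.nodeTm (.var 0 rfl) (.var 2 rfl)) (.var 1 rfl))))).toRH
  · simpa [toTm] using Steps.refl _

/-- `(s, t, r) ↦ (s + 1, (t, r))`, for a numeral `s`. -/
theorem Real₃.succ_pair : Real₃ 𝒟 (fun s t r => node (node leaf s) (node t r)) := by
  refine ⟨lam (lam (lam (nodeTm (nodeTm leafTm (.var 2)) (nodeTm (.var 1) (.var 0))))),
    ⟨⟨fun _ => rfl, fun _ => rfl⟩, ?_⟩,
    fun a b c => .beta₃ a.toTm_isValue b.toTm_isValue c.toTm_isValue ?_⟩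
  · exact (Uses.lam (.lam (.lam (.nodeTm (.nodeTm (.closed (rh_leafTm _)) (.var 2 rfl))
      (.nodeTm (.var 1 rfl) (.var 0 rfl)))))).toRH
  · simpa [toTm] using Steps.refl _

/-- Case distinction on a numeral. -/
theorem Real₂.dispatch (N : ℕ) (f : ℕ → BinTree → BinTree) (hf : ∀ i, Real₁ 𝒟 (f i)) :
    ∃ g, Real₂ 𝒟 g ∧ ∀ i < N, ∀ x, g (num i) x = f i x := by
  induction N generalizing f with
  -- No numeral is below 0, so any function serves here.
  | zero => exact ⟨_, Real₂.fst, by simp⟩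
  | succ N ih =>
    obtain ⟨g, hg, h⟩ := ih (fun i => f (i + 1)) (fun i => hf (i + 1))
    refine ⟨_, hg.drop.elim_left (hf 0), fun i hi x => ?_⟩
    cases i with
    | zero => rfl
    | succ i => exact h i (by omega) x

/-- The variant of `Real₂.dispatch` whose result may have any type. It selects the constructors of
the output string. -/
theorem exists_caseNum {R : Ty 𝒜} (N : ℕ) (V : ℕ → Tm 𝒜) (hV : ∀ i, Comb 𝒟 (V i) R) :
    ∃ H, Comb 𝒟 H (.arrow treeTy R) ∧ ∀ i < N, Steps (H.app (num i).toTm) (V i) := by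
  induction N generalizing V with
  | zero =>
    refine ⟨lam (V 0), ⟨⟨fun σ => ?_, fun σ => ?_⟩, (Uses.lam (.closed (hV 0).rh)).toRH⟩, by simp⟩
    · simp [(hV 0).closed.subst]
    · simp [(hV 0).closed.rename]
  | succ N ih =>
    obtain ⟨H, hH, h⟩ := ih (fun i => V (i + 1)) (fun i => hV (i + 1))
    refine ⟨lam (matchC (.var 0) (lam H) (V 0)), ⟨⟨fun σ => ?_, fun σ => ?_⟩,
      (Uses.lam (.matchC (.var 0 rfl) (Uses.lam (.closed hH.rh)).toRH (hV 0).rh)).toRH⟩,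
      fun i hi => .beta (toTm_isValue _) ?_⟩
    · simp [(hV 0).closed.subst, hH.closed.subst]
    · simp [(hV 0).closed.rename, hH.closed.rename]
    · simp [hH.closed.subst, (hV 0).closed.subst]
      cases i with
      | zero => exact matchC_leaf _ _
      | succ i =>
        refine (matchC_node (toTm_isFree leaf) (num i).toTm_isFree _ _).trans ?_
        refine (Steps.appL (.beta (toTm_isValue leaf) ?_) _).trans (h i (by omega))
        simp [hH.closed.subst]
        exact Steps.refl _

theorem Tm.ofString_subst (s : List Bool) (σ) : (ofString s : Tm 𝒜).subst σ = ofString s :=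
  (ofString_closed s).subst σ

theorem Tm.ofString_rename (s : List Bool) (ρ) : (ofString s : Tm 𝒜).rename ρ = ofString s :=
  (ofString_closed s).rename ρ

theorem Tm.bitTm_subst (b : Bool) (σ) : (bitTm b : Tm 𝒜).subst σ = bitTm b :=
  (bitTm_closed b).subst σ

theorem Tm.bitTm_rename (b : Bool) (ρ) : (bitTm b : Tm 𝒜).rename ρ = bitTm b :=
  (bitTm_closed b).rename ρ

attribute [simp] Tm.ofString_subst Tm.ofString_rename Tm.bitTm_subst Tm.bitTm_rename

/-! ### Iterators -/

/-- A closed value that computes the function `f` on binary trees. -/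
structure FunVal (W : Tm 𝒜) (f : BinTree → BinTree) : Prop where
  closed : W.Closed
  isValue : W.IsValue
  steps : ∀ a, Steps (W.app a.toTm) (f a).toTm

/-- Every computable function on trees can be iterated `N |s|` times, for a string `s` of
tier `m`. -/
def Iterator (𝒟 : Set (Ty 𝒜)) (m : ℕ) (N : ℕ → ℕ) : Prop :=
  ∀ f, Real₁ 𝒟 f → ∃ I, Comb 𝒟 I (.arrow (.base .B m) (toTree treeTy)) ∧
    ∀ s, ∃ W, FunVal W f^[N s.length] ∧ Steps (I.app (ofString s)) W

theorem Iterator.one (m : ℕ) : Iterator 𝒟 m (fun _ => 1) := by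
  rintro f ⟨F, hF, hf⟩
  refine ⟨lam (lam (F.app (.var 0))), ⟨⟨fun σ => ?_, fun σ => ?_⟩,
    (Uses.lam (.lam (.app (.closed hF.rh) (.var 0 rfl)))).toRH⟩,
    -- `F` need not be a value; its eta-expansion is one, as call-by-value reduction requires.
    fun s => ⟨lam (F.app (.var 0)), ⟨⟨fun σ => ?_, fun σ => ?_⟩, .lam _, fun a => ?_⟩, ?_⟩⟩
  · simp [hF.closed.subst]
  · simp [hF.closed.rename]
  · simp [hF.closed.subst]
  · simp [hF.closed.rename]
  · refine .beta a.toTm_isValue ?_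
    simp only [inst_eq, subst_app, subst_var, scons_zero, hF.closed.subst]
    exact hf a
  · refine .beta (ofString_isValue s) ?_
    simp only [inst_eq, subst_app, subst_lam, subst_var, up_zero, hF.closed.subst]
    exact Steps.refl _

/-- The step of the recursion receives the tail, of length `i`, besides the recursive value. Running
the old iterator on that tail adds `N i` applications, and the base case adds one. Linearity is
respected because recursion itself supplies the tails; the result type has level 1, which is why `1
< m` is needed. -/
theorem Iterator.sum {m : ℕ} (hm : 1 < m) {N : ℕ → ℕ} (hN : Iterator 𝒟 m N) :
    Iterator 𝒟 m (fun n => 1 + ∑ i ∈ Finset.range n, N i) := by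
  intro f hf
  obtain ⟨I, hI, hIs⟩ := hN f hf
  obtain ⟨F, hF, hf⟩ := hf
  set R : Tm 𝒜 := lam (lam (lam ((I.app (.var 2)).app ((var 1).app (.var 0))))) with hR
  set B : Tm 𝒜 := lam (F.app (.var 0)) with hB
  have hRc : Comb 𝒟 R (.arrow (.base .B m) (.arrow (toTree treeTy) (toTree treeTy))) :=
    ⟨⟨fun σ => by simp [hR, hI.closed.subst], fun σ => by simp [hR, hI.closed.rename]⟩,
      (Uses.lam (.lam (.lam (.app (.app (.closed hI.rh) (.var 2 rfl))
        (.app (.var 1 rfl) (.var 0 rfl)))))).toRH⟩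
  have hBc : Comb 𝒟 B (toTree treeTy) :=
    ⟨⟨fun σ => by simp [hB, hF.closed.subst], fun σ => by simp [hB, hF.closed.rename]⟩,
      (Uses.lam (.app (.closed hF.rh) (.var 0 rfl))).toRH⟩
  have key : ∀ s : List Bool, ∃ W, FunVal W f^[1 + ∑ i ∈ Finset.range s.length, N i] ∧
      Steps (recB (ofString s) R R B) W := by
    intro s
    induction s with
    | nil =>
      refine ⟨B, ⟨hBc.closed, .lam _, fun a => .beta a.toTm_isValue ?_⟩, recB_nil _ _ _⟩
      simpa [hF.closed.subst] using hf a
    | cons b s ih =>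
      obtain ⟨W, hW, hs⟩ := ih
      obtain ⟨W', hW', hs'⟩ := hIs s
      refine ⟨lam ((I.app (ofString s)).app (W.app (.var 0))),
        ⟨⟨fun σ => ?_, fun σ => ?_⟩, .lam _, fun a => .beta a.toTm_isValue ?_⟩,
        (recB_cons b s _ _ _).trans ?_⟩
      · simp [hI.closed.subst, hW.closed.subst]
      · simp [hI.closed.rename, hW.closed.rename]
      · simp only [inst_eq, subst_app, hI.closed.subst, hW.closed.subst, ofString_subst, subst_var,
          scons_zero]
        refine (hs'.app (hW.steps a)).trans ((hW'.steps _).trans ?_)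
        rw [← Function.iterate_add_apply, List.length_cons, Finset.sum_range_succ,
          show N s.length + (1 + ∑ i ∈ Finset.range s.length, N i) =
            1 + (∑ i ∈ Finset.range s.length, N i + N s.length) by ring]
        exact Steps.refl _
      · rw [Bool.cond_self]
        refine (Steps.appR _ hs).trans (.beta₂ (ofString_isValue s) hW.isValue ?_)
        simpa [hI.closed.subst, hW.closed.rename] using Steps.refl _
  refine ⟨lam (recB (.var 0) R R B), ⟨⟨fun σ => ?_, fun σ => ?_⟩,
    (Uses.lam (.recB (by simpa [Ty.level] using hm) (.var 0 rfl) hRc.rh hRc.rh hBc.rh)).toRH⟩,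
    fun s => ?_⟩
  · simp [hRc.closed.subst, hBc.closed.subst]
  · simp [hRc.closed.rename, hBc.closed.rename]
  · obtain ⟨W, hW, hs⟩ := key s
    refine ⟨W, hW, .beta (ofString_isValue s) ?_⟩
    simpa [hRc.closed.subst, hBc.closed.subst] using hs

theorem Real₁.iterate {f : BinTree → BinTree} (hf : Real₁ 𝒟 f) (n : ℕ) : Real₁ 𝒟 f^[n] := by
  induction n with
  | zero => exact Real₁.id
  | succ n ih => exact ih.comp hf

/-- It suffices to iterate `f^[c]` in place of `f`. -/
theorem Iterator.mul {m : ℕ} {N : ℕ → ℕ} (hN : Iterator 𝒟 m N) (c : ℕ) :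
    Iterator 𝒟 m (fun n => c * N n) := by
  intro f hf
  obtain ⟨I, hI, h⟩ := hN _ (hf.iterate c)
  refine ⟨I, hI, fun s => ?_⟩
  rw [Function.iterate_mul]
  exact h s

/-! ### Exponentiation -/

/-- The number of leaves of a tree. -/
def BinTree.leaves : BinTree → ℕ
  | leaf => 1
  | node a b => a.leaves + b.leaves

/-- The complete tree of a given depth. -/
def BinTree.full : ℕ → BinTree
  | 0 => leaf
  | n + 1 => node (full n) (full n)

theorem BinTree.leaves_full (n : ℕ) : (full n).leaves = 2 ^ n := by
  induction n with
  | zero => rfl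
  | succ n ih => simp only [full, leaves, ih]; ring

/-- `λ r. c r r`, with `c` the binary constructor of `C`. -/
def doubleTm : Tm 𝒜 := lam (nodeTm (.var 0) (.var 0))

/-- The only use of contraction. -/
theorem doubleTm_comb (m : ℕ) (h : .base .C m ∈ 𝒟) :
    Comb 𝒟 doubleTm (.arrow (.base .C m) (.base .C m)) := by
  refine ⟨⟨fun σ => rfl, fun σ => rfl⟩, .lam ?_⟩
  have h₀ : Ctx.bind (.base .C m) (Ctx.empty : Ctx 𝒜) = Ctx.empty.extend 0 (.base .C m) := by
    funext x
    cases x <;> rfl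
  rw [h₀]
  refine RH.contr (M := nodeTm (.var 0) (.var 1)) 0 1 0 _ h (by decide) rfl rfl rfl ?_
  have := (Uses.nodeTm (𝒟 := 𝒟) (Uses.var (l := [some (.base .C m), some (.base .C m)]) 0 rfl)
    (Uses.var 1 rfl)).rh
  convert this using 1
  funext x
  rcases x with _ | _ | x <;> rfl

/-- Doubling at each symbol turns a string of length `n` into the complete tree of depth `n`.
Recursion on that tree, with result type `B^m ⊸ B^m`, composes one successor per leaf. Each of the
two recursions lowers the tier by one. -/
theorem exists_exp (m : ℕ) (h : .base .C (m + 1) ∈ 𝒟) :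
    ∃ E, Comb 𝒟 E (.arrow (.base .B (m + 2)) (.base .B m)) ∧
      ∀ s, ∃ s', s'.length = 2 ^ s.length ∧ Steps (E.app (ofString s)) (ofString s') := by
  have hD := doubleTm_comb _ h
  set D : Tm 𝒜 := doubleTm with hDD
  set R : Tm 𝒜 := lam (lam (D.app (.var 0))) with hR
  set Q : Tm 𝒜 := lam (lam (lam (lam (lam ((var 2).app ((var 1).app (.var 0))))))) with hQ
  set P : Tm 𝒜 := lam ((bitTm true).app (.var 0)) with hP
  have hRc : Comb 𝒟 R (.arrow (.base .B (m + 2))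
      (.arrow (.base .C (m + 1)) (.base .C (m + 1)))) :=
    ⟨⟨fun _ => rfl, fun _ => rfl⟩, (Uses.lam (.lam (.app (.closed hD.rh) (.var 0 rfl)))).toRH⟩
  have hQc : RH 𝒟 Ctx.empty Q (.arrow (.base .C (m + 1)) (.arrow (.base .C (m + 1))
      (.arrow (.arrow (.base .B m) (.base .B m)) (.arrow (.arrow (.base .B m) (.base .B m))
        (.arrow (.base .B m) (.base .B m)))))) :=
    (Uses.lam (.lam (.lam (.lam (.lam (.app (.var 2 rfl) (.app (.var 1 rfl) (.var 0 rfl)))))))).toRH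
  have hPc : RH 𝒟 Ctx.empty P (.arrow (.base .B m) (.base .B m)) :=
    (Uses.lam (.app (.closed (rh_bitTm true m)) (.var 0 rfl))).toRH
  have key₁ : ∀ s : List Bool,
      Steps (recB (ofString s) R R leafTm) (full s.length).toTm := by
    intro s
    induction s with
    | nil => exact recB_nil _ _ _
    | cons b s ih =>
      refine (recB_cons b s _ _ _).trans ?_
      rw [Bool.cond_self]
      refine (Steps.appR _ ih).trans
        (.beta₂ (ofString_isValue s) (toTm_isValue _) ?_)
      simp only [hDD, doubleTm, subst_app, subst_var, subst_lam, up_zero, scons_zero, nodeTm_subst]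
      refine .beta (toTm_isValue _) ?_
      simpa [toTm, full] using Steps.refl _
  -- The tree evaluates to a function that lengthens any string by the number of leaves; at a node
  -- the functions of the subtrees are composed.
  have key₂ : ∀ t : BinTree, ∃ W : Tm 𝒜, W.Closed ∧ W.IsValue ∧
      Steps (recC t.toTm Q P) W ∧
      ∀ s, ∃ s', s'.length = t.leaves + s.length ∧ Steps (W.app (ofString s)) (ofString s') := by
    intro t
    induction t with
    | leaf =>
      refine ⟨P, ⟨fun σ => rfl, fun σ => rfl⟩, .lam _, recC_leaf _ _,
        fun s => ⟨true :: s, ?_, .beta (ofString_isValue s) (Steps.refl _)⟩⟩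
      simp [leaves, add_comm]
    | node a b iha ihb =>
      obtain ⟨V, hV, hVv, hVs, hVl⟩ := iha
      obtain ⟨W, hW, hWv, hWs, hWl⟩ := ihb
      refine ⟨lam (V.app (W.app (.var 0))), ⟨fun σ => ?_, fun σ => ?_⟩, .lam _,
        (recC_node a.toTm_isFree b.toTm_isFree _ _).trans (((Steps.appR _ hVs).app hWs).trans ?_),
        fun s => ?_⟩
      · simp [hV.subst, hW.subst]
      · simp [hV.rename, hW.rename]
      · refine .beta₄ a.toTm_isValue b.toTm_isValue hVv hWv ?_
        simpa [hV.subst, hV.rename, hW.subst, hW.rename] using Steps.refl _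
      · obtain ⟨s₁, hs₁, h₁⟩ := hWl s
        obtain ⟨s₂, hs₂, h₂⟩ := hVl s₁
        refine ⟨s₂, by rw [hs₂, hs₁, leaves]; ring, .beta (ofString_isValue s) ?_⟩
        simp only [inst_eq, subst_app, hV.subst, hW.subst, subst_var, scons_zero]
        exact (Steps.appR _ h₁).trans h₂
  refine ⟨lam ((recC (recB (.var 0) R R leafTm) Q P).app (ofString [])),
    ⟨⟨fun σ => ?_, fun σ => ?_⟩, (Uses.lam (.app (.recC (m := m + 1) (by simp [Ty.level])
      (.recB (by simp [Ty.level]) (.var 0 rfl) hRc.rh hRc.rh (rh_leafTm _)) hQc hPc)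
      (.closed (rh_nil m)))).toRH⟩, fun s => ?_⟩
  · simp [hR, hQ, hP, hDD, doubleTm]
  · simp [hR, hQ, hP, hDD, doubleTm]
  · obtain ⟨W, -, -, hWs, hWl⟩ := key₂ (full s.length)
    obtain ⟨s', hs', h'⟩ := hWl []
    refine ⟨s', by simpa [leaves_full] using hs', .beta (ofString_isValue s) ?_⟩
    simp only [inst_eq, subst_app, recC_subst, recB_subst, ofString_subst, hRc.closed.subst,
      leafTm_subst, subst_var, scons_zero]
    refine (Steps.appL ?_ _).trans h'
    exact (Steps.recur 2 _ (key₁ s)).trans hWs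

theorem Iterator.exp {m : ℕ} {N : ℕ → ℕ} (hN : Iterator 𝒟 m N)
    (h : .base .C (m + 1) ∈ 𝒟) : Iterator 𝒟 (m + 2) (fun n => N (2 ^ n)) := by
  intro f hf
  obtain ⟨I, hI, hIs⟩ := hN f hf
  obtain ⟨E, hE, hEs⟩ := exists_exp m h
  refine ⟨lam (I.app (E.app (.var 0))), ⟨⟨fun σ => ?_, fun σ => ?_⟩,
    (Uses.lam (.app (.closed hI.rh) (.app (.closed hE.rh) (.var 0 rfl)))).toRH⟩, fun s => ?_⟩
  · simp [hI.closed.subst, hE.closed.subst]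
  · simp [hI.closed.rename, hE.closed.rename]
  · obtain ⟨s', hs', h'⟩ := hEs s
    obtain ⟨W, hW, hs⟩ := hIs s'
    refine ⟨W, by rwa [hs'] at hW, .beta (ofString_isValue s) ?_⟩
    simp only [inst_eq, subst_app, hI.closed.subst, hE.closed.subst, subst_var, scons_zero]
    exact (Steps.appR _ h').trans hs

/-! ### Copying, input and output -/

/-- In the absence of pairs, two copies of a string are delivered to a continuation `B^m ⊸ B^m ⊸ R`.
A symbol `b` transforms a continuation `k` into `λ x y. k (b x) (b y)`. The recursion has a result
type of level `m`, hence the argument of tier `m + 1`. -/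
theorem exists_dup {m : ℕ} {R : Ty 𝒜} {K : Tm 𝒜} (hR : R.level ≤ m)
    (hK : Comb 𝒟 K (.arrow (.base .B m) (.arrow (.base .B m) R))) :
    ∃ M, Comb 𝒟 M (.arrow (.base .B (m + 1)) R) ∧
      ∀ s u, Steps ((K.app (ofString s)).app (ofString s)) u → Steps (M.app (ofString s)) u := by
  set Br : Bool → Tm 𝒜 := fun b => lam (lam (lam ((var 1).app (lam (lam
    (((var 2).app ((bitTm b).app (.var 1))).app ((bitTm b).app (.var 0)))))))) with hBr
  set Bn : Tm 𝒜 := lam (((var 0).app (ofString [])).app (ofString [])) with hBn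
  have hBrc : ∀ b, Comb 𝒟 (Br b) (.arrow (.base .B (m + 1))
      (.arrow (.arrow (.arrow (.base .B m) (.arrow (.base .B m) R)) R)
        (.arrow (.arrow (.base .B m) (.arrow (.base .B m) R)) R))) := fun b =>
    ⟨⟨fun σ => by simp [hBr], fun σ => by simp [hBr]⟩,
      (Uses.lam (.lam (.lam (.app (.var 1 rfl) (.lam (.lam (.app (.app (.var 2 rfl)
        (.app (.closed (rh_bitTm b m)) (.var 1 rfl)))
        (.app (.closed (rh_bitTm b m)) (.var 0 rfl))))))))).toRH⟩
  have hBnc : Comb 𝒟 Bn (.arrow (.arrow (.base .B m) (.arrow (.base .B m) R)) R) :=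
    ⟨⟨fun σ => rfl, fun σ => rfl⟩,
      (Uses.lam (.app (.app (.var 0 rfl) (.closed (rh_nil m))) (.closed (rh_nil m)))).toRH⟩
  have key : ∀ s : List Bool, ∃ W : Tm 𝒜, W.Closed ∧ W.IsValue ∧
      Steps (recB (ofString s) (Br false) (Br true) Bn) W ∧
      ∀ k u : Tm 𝒜, k.Closed → k.IsValue → Steps ((k.app (ofString s)).app (ofString s)) u →
        Steps (W.app k) u := by
    intro s
    induction s with
    | nil =>
      refine ⟨Bn, hBnc.closed, .lam _, recB_nil _ _ _, fun k u hk hkv h => .beta hkv ?_⟩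
      simpa using h
    | cons b s ih =>
      obtain ⟨W, hW, hWv, hWs, hWk⟩ := ih
      refine ⟨lam (W.app (lam (lam
        (((var 2).app ((bitTm b).app (.var 1))).app ((bitTm b).app (.var 0)))))),
        ⟨fun σ => ?_, fun σ => ?_⟩, .lam _, (recB_cons b s _ _ _).trans ?_,
        fun k u hk hkv h => .beta hkv ?_⟩
      · simp [hW.subst]
      · simp [hW.rename]
      · have : (bif b then Br true else Br false) = Br b := by cases b <;> rfl
        rw [this]
        refine (Steps.appR _ hWs).trans (.beta₂ (ofString_isValue s) hWv ?_)
        simpa [hW.subst, hW.rename] using Steps.refl _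
      · simp only [inst_eq, subst_app, hW.subst, subst_lam, subst_var, up_zero, up_one, up_two,
          scons_zero, bitTm_subst, hk.rename, rename_var]
        refine hWk _ u ⟨fun σ => ?_, fun σ => ?_⟩ (.lam _) ?_
        · simp [hk.subst]
        · simp [hk.rename]
        · refine .beta₂ (ofString_isValue s) (ofString_isValue s) ?_
          simpa [hk.subst, hk.rename, ofString_cons] using h
  refine ⟨lam ((recB (.var 0) (Br false) (Br true) Bn).app
    (lam (lam ((K.app (.var 1)).app (.var 0))))), ⟨⟨fun σ => ?_, fun σ => ?_⟩,
    (Uses.lam (.app (.recB (m := m + 1) (by simp [Ty.level]; omega) (.var 0 rfl) (hBrc _).rh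
      (hBrc _).rh hBnc.rh)
      (.lam (.lam (.app (.app (.closed hK.rh) (.var 1 rfl)) (.var 0 rfl)))))).toRH⟩,
    fun s u h => .beta (ofString_isValue s) ?_⟩
  · simp [(hBrc _).closed.subst, hBnc.closed.subst, hK.closed.subst]
  · simp [(hBrc _).closed.rename, hBnc.closed.rename, hK.closed.rename]
  · obtain ⟨W, -, -, hWs, hWk⟩ := key s
    simp only [inst_eq, subst_app, recB_subst, (hBrc _).closed.subst, hBnc.closed.subst, subst_var,
      scons_zero, subst_lam, hK.closed.subst, up_zero, up_one, rename_var]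
    refine (Steps.appL hWs _).trans (hWk _ u ⟨fun σ => ?_, fun σ => ?_⟩ (.lam _) ?_)
    · simp [hK.closed.subst]
    · simp [hK.closed.rename]
    · refine .beta₂ (ofString_isValue s) (ofString_isValue s) ?_
      simpa [hK.closed.subst] using h

theorem exists_fold {m : ℕ} (hm : 1 < m) (c : BinTree) (f : Bool → BinTree → BinTree)
    (hf : ∀ b, Real₁ 𝒟 (f b)) :
    ∃ M, Comb 𝒟 M (toTree (.base .B m)) ∧
      ∀ s, Steps (M.app (ofString s)) (s.foldr f c).toTm := by
  choose F hF hf using hf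
  set Br : Bool → Tm 𝒜 := fun b => lam (lam ((F b).app (.var 0))) with hBr
  have hBrc : ∀ b, Comb 𝒟 (Br b) (.arrow (.base .B m) (toTree treeTy)) := fun b =>
    ⟨⟨fun σ => by simp [hBr, (hF b).closed.subst], fun σ => by simp [hBr, (hF b).closed.rename]⟩,
      (Uses.lam (.lam (.app (.closed (hF b).rh) (.var 0 rfl)))).toRH⟩
  have key : ∀ s : List Bool,
      Steps (recB (ofString s) (Br false) (Br true) c.toTm) (s.foldr f c).toTm := by
    intro s
    induction s with
    | nil => exact recB_nil _ _ _
    | cons b s ih =>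
      refine (recB_cons b s _ _ _).trans ?_
      have : (bif b then Br true else Br false) = Br b := by cases b <;> rfl
      rw [this]
      refine (Steps.appR _ ih).trans
        (.beta₂ (ofString_isValue s) (toTm_isValue _) ?_)
      simpa [(hF b).closed.subst] using hf b _
  refine ⟨lam (recB (.var 0) (Br false) (Br true) c.toTm), ⟨⟨fun σ => ?_, fun σ => ?_⟩,
    (Uses.lam (.recB (by simpa [Ty.level] using hm) (.var 0 rfl) (hBrc _).rh (hBrc _).rh
      (c.toTm_rh _))).toRH⟩, fun s => .beta (ofString_isValue s) ?_⟩
  · simp [(hBrc _).closed.subst]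
  · simp [(hBrc _).closed.rename]
  · simpa [(hBrc _).closed.subst] using key s

/-- A list of numerals as a binary tree. -/
def BinTree.stack : List ℕ → BinTree
  | [] => leaf
  | i :: l => node (num i) (stack l)

theorem exists_output (N : ℕ) (p : ℕ → Bool) :
    ∃ M, Comb 𝒟 M (.arrow treeTy (.base .B 0)) ∧ ∀ l : List ℕ, (∀ i ∈ l, i < N) →
      Steps (M.app (stack l).toTm) (ofString (l.map p)) := by
  -- The bound `N + 1` keeps 0 in range even for `N = 0`; 0 is the left component of every nonzero
  -- numeral.
  obtain ⟨H, hH, hHs⟩ := exists_caseNum (𝒟 := 𝒟) (R := .arrow (.base .B 0) (.base .B 0)) (N + 1)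
    (fun i => bitTm (p i)) fun i => ⟨bitTm_closed _, rh_bitTm _ _⟩
  set Q : Tm 𝒜 := lam (lam (lam (lam ((H.app (.var 3)).app (.var 0))))) with hQ
  have hQc : Comb 𝒟 Q (.arrow treeTy (.arrow treeTy
      (.arrow (.base .B 0) (.arrow (.base .B 0) (.base .B 0))))) :=
    ⟨⟨fun σ => by simp [hQ, hH.closed.subst], fun σ => by simp [hQ, hH.closed.rename]⟩,
      (Uses.lam (.lam (.lam (.lam (.app (.app (.closed hH.rh) (.var 3 rfl)) (.var 0 rfl)))))).toRH⟩
  have hnode : ∀ (i : ℕ) (b : BinTree) (s s' : List Bool), i < N + 1 →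
      Steps (recC (num i).toTm Q (ofString [])) (ofString s) →
      Steps (recC b.toTm Q (ofString [])) (ofString s') →
      Steps (recC (node (num i) b).toTm Q (ofString [])) (ofString (p i :: s')) := by
    intro i b s s' hi ha hb
    refine (recC_node (toTm_isFree _) b.toTm_isFree _ _).trans (((Steps.appR _ ha).app hb).trans ?_)
    refine .beta₄ (toTm_isValue _) b.toTm_isValue (ofString_isValue s) (ofString_isValue s') ?_
    simpa [hH.closed.subst, ofString_cons] using Steps.appL (hHs i hi) _
  -- The recursion also descends into the numerals on the stack. Those results are discarded, but
  -- under call-by-value they must first reduce to values.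
  have hnum : ∀ i : ℕ, ∃ s, Steps (recC (num i).toTm Q (ofString [])) (ofString s) := by
    intro i
    induction i with
    | zero => exact ⟨[], recC_leaf _ _⟩
    | succ i ih =>
      obtain ⟨s, hs⟩ := ih
      exact ⟨_, hnode 0 _ [] s (by omega) (recC_leaf _ _) hs⟩
  have key : ∀ l : List ℕ, (∀ i ∈ l, i < N) →
      Steps (recC (stack l).toTm Q (ofString [])) (ofString (l.map p)) := by
    intro l
    induction l with
    | nil => exact fun _ => recC_leaf _ _
    | cons i l ih =>
      intro hl
      obtain ⟨s, hs⟩ := hnum i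
      exact hnode i _ s _ (by have := hl i (by simp); omega) hs
        (ih fun j hj => hl j (by simp [hj]))
  refine ⟨lam (recC (.var 0) Q (ofString [])), ⟨⟨fun σ => ?_, fun σ => ?_⟩,
    (Uses.lam (.recC (by simp [Ty.level]) (.var 0 rfl) hQc.rh (rh_nil 0))).toRH⟩,
    fun l hl => .beta (toTm_isValue _) ?_⟩
  · simp [hQc.closed.subst]
  · simp [hQc.closed.rename]
  · simpa only [inst_eq, recC_subst, hQc.closed.subst, ofString_subst, subst_var, scons_zero]
      using key l hl

/-! ### Tuples of stacks -/

section Stacks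

variable {K : Type}

/-- The stacks with names in a list as a binary tree. -/
def BinTree.tuple (T : K → List ℕ) : List K → BinTree
  | [] => leaf
  | k :: ks => node (stack (T k)) (tuple T ks)

variable [DecidableEq K]

theorem BinTree.tuple_update {k : K} {ks : List K} (hk : k ∉ ks) (T : K → List ℕ) (l : List ℕ) :
    tuple (Function.update T k l) ks = tuple T ks := by
  induction ks with
  | nil => rfl
  | cons k' ks ih =>
    simp only [List.mem_cons, not_or] at hk
    simp only [tuple, ih hk.2, Function.update_of_ne (Ne.symm hk.1)]

/-- The symbol moves rightwards past the other stacks by exchanges until it meets its own stack. -/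
theorem exists_push {k : K} {ks : List K} (hk : k ∈ ks) (hks : ks.Nodup) :
    ∃ f, Real₁ 𝒟 f ∧ ∀ i T, f (node (num i) (tuple T ks)) =
      tuple (Function.update T k (i :: T k)) ks := by
  induction ks with
  | nil => simp at hk
  | cons k' ks ih =>
    obtain ⟨hk', hks⟩ := List.nodup_cons.1 hks
    by_cases h : k = k'
    · subst h
      refine ⟨_, (Real₃.assoc.elim_right .id).elim leaf, fun i T => ?_⟩
      simp only [tuple, tuple_update hk', Function.update_self, stack]
    · obtain ⟨f, hf, hfT⟩ := ih ((List.mem_cons.1 hk).resolve_left h) hks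
      refine ⟨_, (hf.right.elim leaf).comp ((Real₃.exchange.elim_right .id).elim leaf),
        fun i T => ?_⟩
      simp only [tuple, hfT, Function.update_of_ne (Ne.symm h)]

/-- The code of the top of a stack. -/
def headCode : List ℕ → ℕ
  | [] => 0
  | i :: _ => i + 1

/-- The popped code travels back to the front by exchanges. It is shifted by one, since 0 reports an
empty stack. -/
theorem exists_pop {k : K} {ks : List K} (hk : k ∈ ks) (hks : ks.Nodup) :
    ∃ f, Real₁ 𝒟 f ∧ ∀ T, f (tuple T ks) =
      node (num (headCode (T k))) (tuple (Function.update T k (T k).tail) ks) := by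
  induction ks with
  | nil => simp at hk
  | cons k' ks ih =>
    obtain ⟨hk', hks⟩ := List.nodup_cons.1 hks
    by_cases h : k = k'
    · subst h
      refine ⟨_, (Real₃.succ_pair.elim_left ((Real₁.pair leaf).comp (.pair leaf))).elim leaf,
        fun T => ?_⟩
      simp only [tuple, tuple_update hk', Function.update_self]
      cases T k <;> rfl
    · obtain ⟨f, hf, hfT⟩ := ih ((List.mem_cons.1 hk).resolve_left h) hks
      refine ⟨_, ((Real₃.exchange.elim_right .id).elim leaf).comp (hf.right.elim leaf),
        fun T => ?_⟩
      simp only [tuple, hfT, Function.update_of_ne (Ne.symm h)]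

theorem exists_get {k : K} {ks : List K} (hk : k ∈ ks) :
    ∃ f, Real₁ 𝒟 f ∧ ∀ T, f (tuple T ks) = stack (T k) := by
  induction ks with
  | nil => simp at hk
  | cons k' ks ih =>
    by_cases h : k = k'
    · subst h
      exact ⟨_, Real₂.fst.elim leaf, fun T => rfl⟩
    · obtain ⟨f, hf, hfT⟩ := ih ((List.mem_cons.1 hk).resolve_left h)
      exact ⟨_, hf.comp (Real₂.snd.elim leaf), fun T => hfT T⟩

end Stacks

/-- Finitely many codes allow a separately chosen realizer for each case, and injectivity on `B`
makes the code determine the case. Codes not in use get the identity. -/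
theorem exists_dispatch {β : Type} {B : Set β} {c : β → ℕ} (hc : Set.InjOn c B) {N : ℕ}
    (hN : ∀ b ∈ B, c b < N) {P : β → (BinTree → BinTree) → Prop}
    (h : ∀ b ∈ B, ∃ f, Real₁ 𝒟 f ∧ P b f) :
    ∃ g, Real₁ 𝒟 g ∧ ∀ b ∈ B, ∃ f, P b f ∧ ∀ x, g (node (num (c b)) x) = f x := by
  have : ∀ i, ∃ f, Real₁ 𝒟 f ∧ ∀ b ∈ B, c b = i → P b f := by
    intro i
    by_cases hi : ∃ b ∈ B, c b = i
    · obtain ⟨b, hb, rfl⟩ := hi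
      obtain ⟨f, hf, hP⟩ := h b hb
      exact ⟨f, hf, fun b' hb' hbb => hc hb' hb hbb ▸ hP⟩
    · exact ⟨_, .id, fun b hb hbi => (hi ⟨b, hb, hbi⟩).elim⟩
  choose f hf hP using this
  obtain ⟨g, hg, hgf⟩ := Real₂.dispatch N f hf
  exact ⟨_, hg.elim leaf, fun b hb => ⟨f (c b), hP _ b hb rfl, fun x => hgf _ (hN b hb) x⟩⟩

/-! ### Simulation of stack machines -/

section Machine

open Turing Turing.TM2

variable {K : Type} {Γ : K → Type} {Λ σ : Type}

/-- The symbols that a statement pushes. -/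
def pushes : Stmt Γ Λ σ → Set (Σ k, Γ k)
  | .push k f q => Set.range (fun v => ⟨k, f v⟩) ∪ pushes q
  | .peek _ _ q => pushes q
  | .pop _ _ q => pushes q
  | .load _ q => pushes q
  | .branch _ q₁ q₂ => pushes q₁ ∪ pushes q₂
  | .goto _ => ∅
  | .halt => ∅

/-- Stack alphabets are not assumed finite, but a push writes a function of the internal state, so
only finitely many symbols ever need a code. -/
theorem finite_pushes [Finite σ] (q : Stmt Γ Λ σ) : (pushes q).Finite := by
  induction q with
  | push k f q ih => exact (Set.finite_range _).union ih
  | peek _ _ _ ih => exact ih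
  | pop _ _ _ ih => exact ih
  | load _ _ ih => exact ih
  | branch _ _ _ ih₁ ih₂ => exact ih₁.union ih₂
  | goto _ => exact Set.finite_empty
  | halt => exact Set.finite_empty

/-- All symbols on the stacks are in `A`. -/
def ValidStacks (A : Set (Σ k, Γ k)) (S : ∀ k, List (Γ k)) : Prop :=
  ∀ k, ∀ γ ∈ S k, (⟨k, γ⟩ : Σ k, Γ k) ∈ A

/-- The codes of the symbols on the stacks. -/
def stackCodes (e : (Σ k, Γ k) → ℕ) (S : ∀ k, List (Γ k)) (k : K) : List ℕ :=
  (S k).map fun γ => e ⟨k, γ⟩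

/-- A configuration as a binary tree. -/
def cfgTree (ks : List K) (e : (Σ k, Γ k) → ℕ) (e' : Option Λ × σ → ℕ) (c : Cfg Γ Λ σ) :
    BinTree :=
  node (num (e' (c.l, c.var))) (tuple (stackCodes e c.stk) ks)

theorem ValidStacks.update [DecidableEq K] {A : Set (Σ k, Γ k)} {S : ∀ k, List (Γ k)}
    (hS : ValidStacks A S) {k : K} {l : List (Γ k)} (hl : ∀ γ ∈ l, (⟨k, γ⟩ : Σ k, Γ k) ∈ A) :
    ValidStacks A (Function.update S k l) := by
  intro k' γ hγ
  by_cases h : k' = k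
  · subst h
    rw [Function.update_self] at hγ
    exact hl γ hγ
  · rw [Function.update_of_ne h] at hγ
    exact hS k' γ hγ

theorem stackCodes_update [DecidableEq K] (e : (Σ k, Γ k) → ℕ) (S : ∀ k, List (Γ k)) (k : K)
    (l : List (Γ k)) :
    stackCodes e (Function.update S k l) =
      Function.update (stackCodes e S) k (l.map fun γ => e ⟨k, γ⟩) := by
  funext k'
  by_cases h : k' = k
  · subst h
    simp [stackCodes]
  · simp [stackCodes, h]

variable {A : Set (Σ k, Γ k)} {e : (Σ k, Γ k) → ℕ} {N : ℕ} {ks : List K}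

theorem exists_dispatch_head (he : Set.InjOn e A) (hN : ∀ x ∈ A, e x < N) (k : K)
    {P : Option (Γ k) → (BinTree → BinTree) → Prop}
    (h : ∀ o : Option (Γ k), (∀ γ ∈ o, (⟨k, γ⟩ : Σ k, Γ k) ∈ A) → ∃ f, Real₁ 𝒟 f ∧ P o f) :
    ∃ g, Real₁ 𝒟 g ∧ ∀ S, ValidStacks A S → ∃ f, P (S k).head? f ∧
      ∀ x, g (node (num (headCode (stackCodes e S k))) x) = f x := by
  obtain ⟨g, hg, hgf⟩ := exists_dispatch (𝒟 := 𝒟)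
    (B := {o : Option (Γ k) | ∀ γ ∈ o, (⟨k, γ⟩ : Σ k, Γ k) ∈ A})
    (c := fun o => o.elim 0 fun γ => e ⟨k, γ⟩ + 1) (N := N + 1) (P := P) (by
      rintro (_ | γ) ho (_ | γ') ho' hoo
      · rfl
      · simp at hoo
      · simp at hoo
      · have := he (ho γ rfl) (ho' γ' rfl) (by simpa using hoo)
        simpa using this) (by
      rintro (_ | γ) ho
      · simp
      · simpa using hN _ (ho γ rfl)) h
  refine ⟨g, hg, fun S hS => ?_⟩
  obtain ⟨f, hf, hfx⟩ := hgf (S k).head? fun γ hγ => hS k γ (List.mem_of_mem_head? hγ)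
  refine ⟨f, hf, fun x => ?_⟩
  rw [← hfx]
  unfold stackCodes
  cases S k <;> rfl

variable [DecidableEq K]

/-- The internal state `v` is fixed outside the term, so loads and branches cost nothing and only
the stacks are manipulated. A symbol that is read selects, through a dispatch, the realizer for the
new state. The state is written back only at the end, as a code in front of the stacks. -/
theorem exists_stmt (he : Set.InjOn e A) (hN : ∀ x ∈ A, e x < N) (e' : Option Λ × σ → ℕ)
    (hmem : ∀ k, k ∈ ks) (hks : ks.Nodup) (q : Stmt Γ Λ σ) (hq : pushes q ⊆ A) (v : σ) :
    ∃ f, Real₁ 𝒟 f ∧ ∀ S, ValidStacks A S →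
      f (tuple (stackCodes e S) ks) = cfgTree ks e e' (stepAux q v S) ∧
        ValidStacks A (stepAux q v S).stk := by
  induction q generalizing v with
  | push k g q ih =>
    obtain ⟨f, hf, h⟩ := ih (fun x hx => hq (.inr hx)) v
    obtain ⟨p, hp, hpT⟩ := exists_push (𝒟 := 𝒟) (hmem k) hks
    refine ⟨_, hf.comp (hp.comp (.pair (num (e ⟨k, g v⟩)))), fun S hS => ?_⟩
    have := h (Function.update S k (g v :: S k)) (hS.update (by
      intro γ hγ
      rcases List.mem_cons.1 hγ with rfl | hγ
      · exact hq (.inl ⟨v, rfl⟩)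
      · exact hS k γ hγ))
    rw [stackCodes_update] at this
    simp only [hpT]
    exact this
  | peek k g q ih =>
    obtain ⟨p, hp, hpT⟩ := exists_pop (𝒟 := 𝒟) (hmem k) hks
    obtain ⟨r, hr, hrT⟩ := exists_push (𝒟 := 𝒟) (hmem k) hks
    obtain ⟨f, hf, hfS⟩ := exists_dispatch_head (𝒟 := 𝒟) he hN k
      (P := fun o f => ∀ S, ValidStacks A S → (S k).head? = o →
        f (tuple (Function.update (stackCodes e S) k (stackCodes e S k).tail) ks) =
          -- Peeking is popping followed by pushing back the symbol, which is known in each case of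
          -- the dispatch.
          cfgTree ks e e' (stepAux q (g v o) S) ∧ ValidStacks A (stepAux q (g v o) S).stk) (by
      intro o ho
      obtain ⟨f, hf, h⟩ := ih hq (g v o)
      cases o with
      | none =>
        refine ⟨f, hf, fun S hS hh => ?_⟩
        have : (stackCodes e S k).tail = stackCodes e S k := by
          simp [stackCodes, List.head?_eq_none_iff.1 hh]
        rw [this, Function.update_eq_self]
        exact h S hS
      | some γ =>
        refine ⟨_, hf.comp (hr.comp (.pair (num (e ⟨k, γ⟩)))), fun S hS hh => ?_⟩
        obtain ⟨l, hl⟩ := List.head?_eq_some_iff.1 hh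
        have : e ⟨k, γ⟩ :: (stackCodes e S k).tail = stackCodes e S k := by
          simp [stackCodes, hl]
        simp only [hrT, Function.update_self, Function.update_idem, this, Function.update_eq_self]
        exact h S hS)
    refine ⟨_, hf.comp hp, fun S hS => ?_⟩
    obtain ⟨f', hf', hx⟩ := hfS S hS
    simp only [hpT, hx]
    exact hf' S hS rfl
  | pop k g q ih =>
    obtain ⟨p, hp, hpT⟩ := exists_pop (𝒟 := 𝒟) (hmem k) hks
    obtain ⟨f, hf, hfS⟩ := exists_dispatch_head (𝒟 := 𝒟) he hN k
      (P := fun o f => ∀ S, ValidStacks A S →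
        f (tuple (stackCodes e S) ks) = cfgTree ks e e' (stepAux q (g v o) S) ∧
          ValidStacks A (stepAux q (g v o) S).stk) fun o _ => ih hq (g v o)
    refine ⟨_, hf.comp hp, fun S hS => ?_⟩
    obtain ⟨f', hf', hx⟩ := hfS S hS
    have := hf' (Function.update S k (S k).tail)
      (hS.update fun γ hγ => hS k γ (List.mem_of_mem_tail hγ))
    rw [stackCodes_update, List.map_tail] at this
    simp only [hpT, hx]
    exact this
  | load g q ih => exact ih hq (g v)
  | branch p q₁ q₂ ih₁ ih₂ =>
    cases h : p v
    · simpa only [stepAux, h, cond_true, cond_false] using ih₂ (fun x hx => hq (.inr hx)) v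
    · simpa only [stepAux, h, cond_true, cond_false] using ih₁ (fun x hx => hq (.inl hx)) v
  | goto g => exact ⟨_, .pair (num (e' (some (g v), v))), fun S hS => ⟨rfl, hS⟩⟩
  | halt => exact ⟨_, .pair (num (e' (none, v))), fun S hS => ⟨rfl, hS⟩⟩

/-- One step of a machine, with halting configurations as fixed points. -/
def totalStep (M : Λ → Stmt Γ Λ σ) (c : Cfg Γ Λ σ) : Cfg Γ Λ σ := (step M c).getD c

theorem exists_step (he : Set.InjOn e A) (hN : ∀ x ∈ A, e x < N) {e' : Option Λ × σ → ℕ}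
    (he' : Function.Injective e') {N' : ℕ} (hN' : ∀ x, e' x < N')
    (hmem : ∀ k, k ∈ ks) (hks : ks.Nodup) (M : Λ → Stmt Γ Λ σ) (hM : ∀ l, pushes (M l) ⊆ A) :
    ∃ f, Real₁ 𝒟 f ∧ ∀ c, ValidStacks A c.stk → f (cfgTree ks e e' c) =
      cfgTree ks e e' (totalStep M c) ∧ ValidStacks A (totalStep M c).stk := by
  obtain ⟨g, hg, h⟩ := exists_dispatch (𝒟 := 𝒟) (B := Set.univ) (c := e') he'.injOn
    (fun x _ => hN' x) (P := fun x f => ∀ S, ValidStacks A S →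
      f (tuple (stackCodes e S) ks) = cfgTree ks e e' (totalStep M ⟨x.1, x.2, S⟩) ∧
        ValidStacks A (totalStep M ⟨x.1, x.2, S⟩).stk) (by
      rintro ⟨_ | l, v⟩ -
      · exact ⟨_, .pair (num (e' (none, v))), fun S hS => ⟨rfl, hS⟩⟩
      · exact exists_stmt he hN e' hmem hks (M l) (hM l) v)
  refine ⟨g, hg, fun c hc => ?_⟩
  obtain ⟨f, hf, hx⟩ := h (c.l, c.var) trivial
  obtain ⟨l, v, S⟩ := c
  unfold cfgTree at hf ⊢
  rw [hx]
  exact hf S hc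

/-- Surplus iterations are harmless because the halting configuration is a fixed point. -/
theorem iterate_totalStep {M : Λ → Stmt Γ Λ σ} {n m : ℕ} {a b : Cfg Γ Λ σ} (hnm : n ≤ m)
    (h : (flip bind (step M))^[n] (some a) = some b) (hb : b.l = none) :
    (totalStep M)^[m] a = b := by
  have hfix : totalStep M b = b := by
    obtain ⟨l, v, S⟩ := b
    subst hb
    rfl
  have key : (totalStep M)^[n] a = b := by
    clear hnm
    induction n generalizing a with
    | zero => simpa using h
    | succ n ih =>
      rw [Function.iterate_succ_apply] at h ⊢
      have hs : flip bind (step M) (some a) = step M a := rfl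
      rw [hs] at h
      cases ha : step M a with
      | none =>
        rw [ha] at h
        have : ∀ n, (flip bind (step M))^[n] (none : Option (Cfg Γ Λ σ)) = none := by
          intro n
          induction n with
          | zero => rfl
          | succ n ih => rw [Function.iterate_succ_apply]; exact ih
        exact absurd ((this n).symm.trans h) (by simp)
      | some a' =>
        rw [ha] at h
        have : totalStep M a = a' := by simp [totalStep, ha]
        rw [this]
        exact ih h
  obtain ⟨d, rfl⟩ := Nat.exists_eq_add_of_le' hnm
  rw [Function.iterate_add_apply, key]
  exact Function.iterate_fixed hfix d

end Machine

open Turing in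
theorem exists_represents {f : List Bool → List Bool}
    (h : TM2ComputableInTime (id : List Bool → List Bool) id f) {m : ℕ} (hm : 1 < m)
    {N : ℕ → ℕ} (hN : Iterator 𝒟 m N) (hle : ∀ n, h.time n ≤ N n) :
    ∃ M, RH 𝒟 Ctx.empty M (.arrow (.base .B (m + 1)) (.base .B 0)) ∧ M.Represents f := by
  obtain ⟨⟨tm, ein, eout⟩, time, hout⟩ := h
  dsimp only at hle hout
  have := tm.kFin
  have := tm.ΛFin
  have := tm.σFin
  have := tm.Γk₀Fin
  -- The input symbols must be valid at the start, and the output symbols need distinct codes for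
  -- decoding.
  set A : Set (Σ k, tm.Γ k) := (⋃ l, pushes (tm.m l)) ∪
    (Set.range (fun b => ⟨tm.k₀, ein.invFun b⟩) ∪ Set.range (fun b => ⟨tm.k₁, eout.invFun b⟩))
    with hA
  have hAfin : A.Finite := (Set.finite_iUnion fun l => finite_pushes _).union
    ((Set.finite_range _).union (Set.finite_range _))
  obtain ⟨e, he⟩ := Set.countable_iff_exists_injOn.1 hAfin.countable
  obtain ⟨N₀, hN₀⟩ := (hAfin.image e).bddAbove
  have hN₁ : ∀ x ∈ A, e x < N₀ + 1 := fun x hx => Nat.lt_succ_of_le (hN₀ ⟨x, hx, rfl⟩)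
  obtain ⟨e', he'⟩ := Countable.exists_injective_nat (Option tm.Λ × tm.σ)
  obtain ⟨N₂, hN₂⟩ := (Set.finite_range e').bddAbove
  have hN₃ : ∀ x, e' x < N₂ + 1 := fun x => Nat.lt_succ_of_le (hN₂ ⟨x, rfl⟩)
  set ks : List tm.K := Finset.univ.toList with hks
  have hmem : ∀ k, k ∈ ks := fun k => by simp [hks]
  have hnd : ks.Nodup := Finset.nodup_toList _
  obtain ⟨F, hF, hFc⟩ := exists_step (𝒟 := 𝒟) he hN₁ he' hN₃ hmem hnd tm.m
    fun l x hx => .inl (Set.mem_iUnion.2 ⟨l, hx⟩)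
  have hiter : ∀ n c, ValidStacks A c.stk →
      F^[n] (cfgTree ks e e' c) = cfgTree ks e e' ((totalStep tm.m)^[n] c) ∧
        ValidStacks A ((totalStep tm.m)^[n] c).stk := by
    intro n
    induction n with
    | zero => exact fun c hc => ⟨rfl, hc⟩
    | succ n ih =>
      intro c hc
      rw [Function.iterate_succ_apply, Function.iterate_succ_apply, (hFc c hc).1]
      exact ih _ (hFc c hc).2
  obtain ⟨I, hI, hIs⟩ := hN F hF
  obtain ⟨p, hp, hpT⟩ := exists_push (𝒟 := 𝒟) (hmem tm.k₀) hnd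
  obtain ⟨g, hg, hgT⟩ := exists_get (𝒟 := 𝒟) (hmem tm.k₁)
  set start : List Bool → tm.Cfg := fun s =>
    ⟨some tm.main, tm.initialState, Function.update (fun _ => []) tm.k₀ (s.map ein.invFun)⟩
    with hstart
  -- The initial configuration arises from the one for the empty input by pushing the input symbols
  -- from last to first.
  obtain ⟨J, hJ, hJs⟩ := exists_fold (𝒟 := 𝒟) hm (cfgTree ks e e' (start []))
    (fun b => _) fun b => (hp.comp (.pair (num (e ⟨tm.k₀, ein.invFun b⟩)))).right.elim leaf
  have hJs' : ∀ s, Steps (J.app (ofString s)) (cfgTree ks e e' (start s)).toTm := by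
    intro s
    convert hJs s using 2
    induction s with
    | nil => rfl
    | cons b s ih =>
      rw [List.foldr_cons, ← ih]
      simp only [cfgTree, hstart, hpT, stackCodes_update, Function.update_self,
        Function.update_idem, List.map_cons]
  obtain ⟨O, hO, hOs⟩ := exists_output (𝒟 := 𝒟) (N₀ + 1)
    (fun i => decide (i = e ⟨tm.k₁, eout.invFun true⟩))
  obtain ⟨G, hG, hGs⟩ := (hg.comp (Real₂.snd.elim leaf))
  -- One copy of the input drives the iterator `I`, the other is loaded by `J`; `G` extracts the
  -- output stack and `O` decodes it.
  obtain ⟨M, hM, hMs⟩ := exists_dup (𝒟 := 𝒟) (m := m) (R := .base .B 0)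
    (K := lam (lam (O.app (G.app ((I.app (.var 1)).app (J.app (.var 0))))))) (Nat.zero_le _)
    ⟨⟨fun σ => by
        simp [hO.closed.subst, hG.closed.subst, hI.closed.subst, hJ.closed.subst], fun σ => by
        simp [hO.closed.rename, hG.closed.rename, hI.closed.rename, hJ.closed.rename]⟩,
      (Uses.lam (.lam (.app (.closed hO.rh) (.app (.closed hG.rh)
        (.app (.app (.closed hI.rh) (.var 1 rfl)) (.app (.closed hJ.rh) (.var 0 rfl))))))).toRH⟩
  refine ⟨M, hM.rh, fun s => hMs s _ (.beta₂ (ofString_isValue s) (ofString_isValue s) ?_)⟩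
  simp only [subst_app, hO.closed.subst, hG.closed.subst, hI.closed.subst, hJ.closed.subst,
    subst_var, up_zero, up_one, scons_zero, ofString_rename, ofString_subst]
  obtain ⟨W, hW, hWs⟩ := hIs s
  refine (Steps.appR _ (Steps.appR _ (hWs.app (hJs' s)))).trans
    ((Steps.appR _ (Steps.appR _ (hW.steps _))).trans ?_)
  have hstk : ∀ k₁ (l : List (tm.Γ k₁)) k, (@dite (List (tm.Γ k)) (k = k₁)
      (tm.kDecidableEq k k₁) (fun h => by rw [h]; exact l) fun _ => []) =
      Function.update (fun _ => []) k₁ l k := by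
    intro k₁ l k
    by_cases h : k = k₁
    · subst h
      simp
    · simp [h]
  have hinit : initList tm (s.map ein.invFun) = start s := by
    unfold initList
    congr 1
    funext k
    exact hstk _ _ k
  have hrun := iterate_totalStep ((hout s).steps_le_m.trans (hle _)) (hout s).evals_in_steps rfl
  simp only [id] at hrun
  rw [hinit] at hrun
  obtain ⟨h₁, h₂⟩ := hiter (N s.length) (start s) (ValidStacks.update (fun k γ hγ => by simp at hγ)
    fun γ hγ => by
      obtain ⟨b, -, rfl⟩ := List.mem_map.1 hγ
      exact .inr (.inl ⟨b, rfl⟩))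
  rw [h₁, hrun]
  refine (Steps.appR _ (hGs _)).trans ?_
  have hcodes : stackCodes e (haltList tm ((f s).map eout.invFun)).stk tm.k₁ =
      (f s).map fun b => e ⟨tm.k₁, eout.invFun b⟩ := by
    have : (haltList tm ((f s).map eout.invFun)).stk tm.k₁ = (f s).map eout.invFun :=
      (hstk _ _ _).trans (Function.update_self ..)
    rw [stackCodes, this, List.map_map]
    rfl
  simp only [cfgTree, hgT, hcodes]
  convert hOs _ _ using 2
  · rw [List.map_map]
    conv_lhs => rw [← List.map_id (f s)]
    refine List.map_congr_left fun b _ => ?_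
    have : e ⟨tm.k₁, eout.invFun b⟩ = e ⟨tm.k₁, eout.invFun true⟩ ↔ b = true := by
      constructor
      · intro hb
        have := he (.inr (.inr ⟨b, rfl⟩)) (.inr (.inr ⟨true, rfl⟩)) hb
        simpa using this
      · rintro rfl
        rfl
    simp only [id, Function.comp, this, Bool.decide_eq_true]
  · intro i hi
    obtain ⟨b, -, rfl⟩ := List.mem_map.1 hi
    exact hN₁ _ (.inr (.inr ⟨b, rfl⟩))

/-! ### Bounds -/

/-- Discrete integration: consecutive values of `(n + 1) ^ (k + 1)` differ by at most `(k + 1) * (n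
+ 2) ^ k ≤ (k + 1) * 2 ^ k * (n + 1) ^ k`, which explains the factor in the summand. -/
theorem Iterator.pow {m : ℕ} (hm : 1 < m) (k : ℕ) :
    ∃ N, Iterator 𝒟 m N ∧ ∀ n, (n + 1) ^ k ≤ N n := by
  induction k with
  | zero => exact ⟨_, .one m, fun n => by simp⟩
  | succ k ih =>
    obtain ⟨N, hN, h⟩ := ih
    refine ⟨_, (hN.mul ((k + 1) * 2 ^ k)).sum hm, fun n => ?_⟩
    induction n with
    | zero => simp
    | succ n ih =>
      rw [Finset.sum_range_succ, ← add_assoc]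
      have h₁ : (n + 1 + 1) ^ (k + 1) ≤ (n + 1) ^ (k + 1) + (k + 1) * (n + 1 + 1) ^ k := by
        have : ∀ j, (n + 1 + 1) ^ (j + 1) ≤ (n + 1) ^ (j + 1) + (j + 1) * (n + 1 + 1) ^ j := by
          intro j
          induction j with
          | zero => simp
          | succ j ihj =>
            have h₂ : (n + 1) ^ (j + 1) ≤ (n + 1 + 1) ^ (j + 1) :=
              Nat.pow_le_pow_left (by omega) _
            calc (n + 1 + 1) ^ (j + 1 + 1)
                = (n + 1) * (n + 1 + 1) ^ (j + 1) + (n + 1 + 1) ^ (j + 1) := by ring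
              _ ≤ (n + 1) * ((n + 1) ^ (j + 1) + (j + 1) * (n + 1 + 1) ^ j) +
                  (n + 1 + 1) ^ (j + 1) := by gcongr
              _ ≤ (n + 1) * (n + 1) ^ (j + 1) + (n + 1 + 1) * ((j + 1) * (n + 1 + 1) ^ j) +
                  (n + 1 + 1) ^ (j + 1) := by
                rw [mul_add]
                gcongr
                omega
              _ = _ := by ring
        exact this k
      have h₃ : (n + 1 + 1) ^ k ≤ 2 ^ k * (n + 1) ^ k := by
        rw [← mul_pow]
        exact Nat.pow_le_pow_left (by omega) _
      calc (n + 1 + 1) ^ (k + 1) ≤ (n + 1) ^ (k + 1) + (k + 1) * (n + 1 + 1) ^ k := h₁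
        _ ≤ (n + 1) ^ (k + 1) + (k + 1) * (2 ^ k * (n + 1) ^ k) := by gcongr
        _ = (n + 1) ^ (k + 1) + (k + 1) * 2 ^ k * (n + 1) ^ k := by ring
        _ ≤ _ := add_le_add ih (Nat.mul_le_mul_left _ (h n))

theorem Iterator.polynomial {m : ℕ} (hm : 1 < m) (p : Polynomial ℕ) :
    ∃ N, Iterator 𝒟 m N ∧ ∀ n, p.eval n ≤ N n := by
  obtain ⟨N, hN, h⟩ := Iterator.pow (𝒟 := 𝒟) hm p.natDegree
  refine ⟨_, hN.mul (∑ i ∈ Finset.range (p.natDegree + 1), p.coeff i), fun n => ?_⟩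
  rw [Polynomial.eval_eq_sum_range, Finset.sum_mul]
  refine Finset.sum_le_sum fun i hi => Nat.mul_le_mul_left _ (le_trans ?_ (h n))
  calc n ^ i ≤ (n + 1) ^ i := Nat.pow_le_pow_left (by omega) _
    _ ≤ (n + 1) ^ p.natDegree :=
      Nat.pow_le_pow_right (by omega) (Nat.lt_succ_iff.1 (Finset.mem_range.1 hi))

/-- The tower of `k` twos with top exponent `n`. -/
def tower (k n : ℕ) : ℕ := (fun x => 2 ^ x)^[k] n

theorem tower_succ (k n : ℕ) : tower (k + 1) n = 2 ^ tower k n :=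
  Function.iterate_succ_apply' _ _ _

theorem tower_add (j k n : ℕ) : tower (j + k) n = tower j (tower k n) :=
  Function.iterate_add_apply _ _ _ _

theorem tower_mono_left {j k : ℕ} (h : j ≤ k) (n : ℕ) : tower j n ≤ tower k n :=
  monotone_nat_of_le_succ (f := fun k => tower k n)
    (fun k => by rw [tower_succ]; exact Nat.lt_two_pow_self.le) h

theorem two_mul_le_two_pow (n : ℕ) : 2 * n ≤ 2 ^ n := by
  cases n with
  | zero => simp
  | succ n =>
    rw [pow_succ']
    exact Nat.mul_le_mul_left _ Nat.lt_two_pow_self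

theorem mul_self_le_tower (n : ℕ) : n * n ≤ tower 2 n :=
  calc n * n ≤ 2 ^ n * 2 ^ n := Nat.mul_le_mul Nat.lt_two_pow_self.le Nat.lt_two_pow_self.le
    _ = 2 ^ (2 * n) := by rw [two_mul, pow_add]
    _ ≤ tower 2 n := Nat.pow_le_pow_right (by omega) (two_mul_le_two_pow n)

theorem pow_self_le_tower (n : ℕ) : n ^ n ≤ tower 3 n :=
  calc n ^ n ≤ (2 ^ n) ^ n := Nat.pow_le_pow_left Nat.lt_two_pow_self.le n
    _ = 2 ^ (n * n) := by rw [pow_mul]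
    _ ≤ tower 3 n := by
      rw [tower_succ]
      exact Nat.pow_le_pow_right (by omega) (mul_self_le_tower n)

/-- With all arguments bounded by `x`, composition adds heights; a bounded sum is at most the square
of a tower, and a bounded product at most a tower raised to itself. -/
theorem Elementary.le_tower {n : ℕ} {f : (Fin n → ℕ) → ℕ} (hf : Elementary f) :
    ∃ k, ∀ v x, (∀ i, v i ≤ x) → f v ≤ tower k x := by
  induction hf with
  | zero => exact ⟨0, fun _ _ _ => Nat.zero_le _⟩
  | succ =>
    refine ⟨1, fun v x hx => ?_⟩
    calc v 0 + 1 ≤ x + 1 := Nat.succ_le_succ (hx 0)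
      _ ≤ 2 ^ x := Nat.lt_two_pow_self
  | proj i => exact ⟨0, fun v x hx => hx i⟩
  | add =>
    refine ⟨1, fun v x hx => ?_⟩
    calc v 0 + v 1 ≤ 2 * x := by have := hx 0; have := hx 1; omega
      _ ≤ 2 ^ x := two_mul_le_two_pow x
  | tsub => exact ⟨0, fun v x hx => (Nat.sub_le _ _).trans (hx 0)⟩
  | @comp m n f g _ _ ihf ihg =>
    obtain ⟨k, hk⟩ := ihf
    choose k' hk' using ihg
    refine ⟨k + Finset.univ.sup k', fun v x hx => ?_⟩
    rw [tower_add]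
    exact hk _ _ fun i => (hk' i v x hx).trans
      (tower_mono_left (Finset.le_sup (Finset.mem_univ i)) x)
  | @bsum n f _ ih =>
    obtain ⟨k, hk⟩ := ih
    refine ⟨2 + k, fun v x hx => ?_⟩
    have hx' : x ≤ tower k x := tower_mono_left (Nat.zero_le k) x
    calc ∑ i ∈ Finset.range (v 0), f (Fin.cons i (Fin.tail v))
        ≤ (Finset.range (v 0)).card • tower k x := Finset.sum_le_card_nsmul _ _ _ fun i hi =>
          hk _ _ (Fin.cases ((Finset.mem_range.1 hi).le.trans (hx 0)) fun j => hx j.succ)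
      _ ≤ tower k x * tower k x := by
        rw [Finset.card_range, smul_eq_mul]
        exact Nat.mul_le_mul_right _ ((hx 0).trans hx')
      _ ≤ tower (2 + k) x := by
        rw [tower_add]
        exact mul_self_le_tower _
  | @bprod n f _ ih =>
    obtain ⟨k, hk⟩ := ih
    -- The extra level makes the base at least 1, so that the power is monotone in its exponent.
    refine ⟨3 + (k + 1), fun v x hx => ?_⟩
    have hx' : x ≤ tower (k + 1) x := tower_mono_left (Nat.zero_le _) x
    have h1 : 1 ≤ tower (k + 1) x := by rw [tower_succ]; exact Nat.one_le_two_pow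
    calc ∏ i ∈ Finset.range (v 0), f (Fin.cons i (Fin.tail v))
        ≤ tower (k + 1) x ^ (Finset.range (v 0)).card :=
          Finset.prod_le_pow_card _ _ _ fun i hi =>
          (hk _ _ (Fin.cases ((Finset.mem_range.1 hi).le.trans (hx 0)) fun j => hx j.succ)).trans
            (tower_mono_left (Nat.le_succ k) x)
      _ ≤ tower (k + 1) x ^ tower (k + 1) x := by
        rw [Finset.card_range]
        exact Nat.pow_le_pow_right h1 ((hx 0).trans hx')
      _ ≤ tower (3 + (k + 1)) x := by
        rw [tower_add 3]
        exact pow_self_le_tower _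

theorem Iterator.tower (h : Ty.baseTypes 𝒜 ⊆ 𝒟) (k : ℕ) :
    ∃ m N, 1 < m ∧ Iterator 𝒟 m N ∧ ∀ n, tower k n ≤ N n := by
  have : ∀ k, ∃ m, 1 < m ∧
      Iterator 𝒟 m (fun n => 1 + ∑ _i ∈ Finset.range (LinRec.tower k n), 1) := by
    intro k
    induction k with
    | zero => exact ⟨2, by omega, (Iterator.one 2).sum (by omega)⟩
    | succ k ih =>
      obtain ⟨m, hm, hN⟩ := ih
      exact ⟨m + 2, by omega, hN.exp (h ⟨.C, m + 1, rfl⟩)⟩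
  obtain ⟨m, hm, hN⟩ := this k
  exact ⟨m, _, hm, hN, fun n => by simp⟩

end LinRec

/-! ### Polynomial and elementary time. -/

theorem mainTheorem7 (𝒜 : LinRec.Family) :
    (∀ f : List Bool → List Bool, LinRec.PolyTimeComputable f →
      ∃ (M : LinRec.Tm 𝒜) (n : ℕ),
        LinRec.RH ∅ LinRec.Ctx.empty M (.arrow (.base .B n) (.base .B 0)) ∧
        M.Represents f) ∧
    (∀ f : List Bool → List Bool, LinRec.ElementaryTimeComputable f →
      ∃ (M : LinRec.Tm 𝒜) (n : ℕ),
        LinRec.RH (LinRec.Ty.baseTypes 𝒜) LinRec.Ctx.empty M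
          (.arrow (.base .B n) (.base .B 0)) ∧
        M.Represents f) := by
  constructor
  · rintro f ⟨h⟩
    obtain ⟨N, hN, hle⟩ := LinRec.Iterator.polynomial (𝒟 := (∅ : Set (LinRec.Ty 𝒜)))
      (m := 2) (by omega) h.time
    obtain ⟨M, hM⟩ := LinRec.exists_represents h.toTM2ComputableInTime (by omega) hN hle
    exact ⟨M, _, hM⟩
  · rintro f ⟨h, he⟩
    obtain ⟨k, hk⟩ := he.le_tower
    obtain ⟨m, N, hm, hN, hle⟩ := LinRec.Iterator.tower (le_refl (LinRec.Ty.baseTypes 𝒜)) k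
    obtain ⟨M, hM⟩ := LinRec.exists_represents h hm hN fun n =>
      (hk (fun _ => n) n fun _ => le_rfl).trans (hle n)
    exact ⟨M, _, hM⟩
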